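/- Let $r\ge 3$ be an odd integer and $q=e^{2\pi i/r}$. For an indeterminate $A$ put $[k]_A=\frac{A^{2k}-A^{-2k}}{A^2-A^{-2}}$, and let $\mathrm{TL}_A$ be the Temperley–Lieb category over $\mathbb C(A)$: its objects are the integers $m\ge 0$, the morphisms $m\to m'$ are linear combinations of planar $(m,m')$-tangles, and a closed component is replaced by $-[2]_A$. Let $f_0=\mathrm{id}_0$, $f_1=\mathrm{id}_1$ and $$f_m=f_{m-1}\otimes \mathrm{id}_1+\tfrac{[m-1]_A}{[m]_A}\,(f_{m-1}\otimes \mathrm{id}_1)(\mathrm{id}_{m-2}\otimes \cup\cap)(f_{m-1}\otimes \mathrm{id}_1)\qquad(m\ge 2)$$ be the Jones–Wenzl idempotents, and for $r\le m\le 2r-2$ let $g_m=f_m+\frac{1}{[r]_A}h_m$, where, with $s=m-r+1$, $$h_m=(-1)^m[2r-m-1]_A\,(f_{r-1}\otimes \mathrm{id}_s)(\mathrm{id}_{2r-m-2}\otimes \cup_s\cap_s)(f_{r-1}\otimes \mathrm{id}_s)$$ and $\cup_s$, $\cap_s$ denote $s$ nested cups and $s$ nested caps. Let $t_n=f_n$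 for $0\le n\le r-1$ and $t_n=g_n$ for $r\le n\le 2r-2$. Then all the coefficients of $t_n$ ($0\le n\le 2r-2$) and of $f_{2r-1}$ in the basis of planar tangles without closed components are regular at $A=q^{(r+1)/2}$, so that these morphisms can be specialized to the Temperley–Lieb category $\mathrm{TL}$ over $\mathbb C$ with $A=q^{(r+1)/2}$; their specializations are denoted by the same symbols. Let $\widetilde{\mathrm{TL}}$ be the extended Temperley–Lieb category, that is, the strict monoidal $\mathbb C$-linear category with objects the integers $m\ge 0$ which is generated by $\mathrm{TL}$ and by morphisms $p^{\pm}:2r-1\to r-1$ and $i^{\pm}:r-1\to 2r-1$ satisfying $p^\varepsilon f_{2r-1}=p^\varepsilon=f_{r-1}p^\varepsilon$, $i^\varepsilon f_{r-1}=i^\varepsilon=f_{2r-1}i^\varepsilon$ and the following relations, for all $0\le m\le r-1$ and $\varepsilon,\varepsilon'\in\{+,-\}$: \begin{align*} (\mathrm{id}_m\otimes p^\varepsilon)(i^{\varepsilon'}\otimes \mathrm{id}_m)&=\delta_{\varepsilon,\varepsilon'}(\mathrm{id}_m\otimes f_{r-1})(f_{r-1}\otimes \mathrm{id}_m),\\ (p^\varepsilon\otimes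 \mathrm{id}_m)(\mathrm{id}_m\otimes i^{\varepsilon'})&=\delta_{\varepsilon,\varepsilon'}(f_{r-1}\otimes \mathrm{id}_m)(\mathrm{id}_m\otimes f_{r-1}),\\ \sum_{\varepsilon}(\mathrm{id}_m\otimes i^\varepsilon)(p^\varepsilon\otimes \mathrm{id}_m)&=(\mathrm{id}_m\otimes f_{2r-1})(f_{2r-1}\otimes \mathrm{id}_m),\\ \sum_{\varepsilon}(i^\varepsilon\otimes \mathrm{id}_m)(\mathrm{id}_m\otimes p^\varepsilon)&=(f_{2r-1}\otimes \mathrm{id}_m)(\mathrm{id}_m\otimes f_{2r-1}),\\ (\mathrm{id}_{2r-2}\otimes\cap)(i^\varepsilon\otimes \mathrm{id}_1)&=-(\cap\otimes \mathrm{id}_{2r-2})(\mathrm{id}_1\otimes i^\varepsilon),\\ (p^\varepsilon\otimes \mathrm{id}_1)(\mathrm{id}_{2r-2}\otimes\cup)&=-(\mathrm{id}_1\otimes p^\varepsilon)(\cup\otimes \mathrm{id}_{2r-2}). \end{align*} Then for every object $m$ of $\widetilde{\mathrm{TL}}$ there exist, for every $0\le n\le 2r-2$, a finite set $J_{m,n}$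 and morphisms $u_m^{n,j}\in\widetilde{\mathrm{TL}}(m,n)$ and $v^m_{n,j}\in\widetilde{\mathrm{TL}}(n,m)$ for $j\in J_{m,n}$, such that $$\mathrm{id}_m=\sum_{n=0}^{2r-2}\ \sum_{j\in J_{m,n}} v^m_{n,j}\,t_n\,u_m^{n,j}.$$ -/

import Mathlib

open CategoryTheory

noncomputable section

/-! ## Planar matchings

A planar `(m, n)`-tangle without closed components is, up to isotopy, a non-crossing perfect
matching of its `m` bottom and `n` top endpoints. The `n + m` endpoints are numbered from `0`
along the boundary of the square: first the top ones from left to right, then the bottom ones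
from right to left. -/

/-- `σ` restricts to a fixed-point-free involution of `{0, …, N - 1}` whose arcs `{x, σ x}` do not
cross; for uniqueness of the representation `σ` is the identity beyond `N`. -/
def IsPlanarMatching (N : ℕ) (σ : ℕ → ℕ) : Prop :=
  (∀ x, N ≤ x → σ x = x) ∧ (∀ x, x < N → σ x < N ∧ σ x ≠ x) ∧ (∀ x, σ (σ x) = x) ∧
    ∀ x y, x < y → y < σ x → x < σ y ∧ σ y < σ x

/-- Non-crossing perfect matchings of `N` points. -/
def PlanarMatching (N : ℕ) : Type := {σ : ℕ → ℕ // IsPlanarMatching N σ}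

namespace PlanarMatching

/-- Join the points `i` and `i + 1` by an arc, remove them and renumber the others. -/
def closeAt (i : ℕ) (σ : ℕ → ℕ) (x : ℕ) : ℕ :=
  let skip : ℕ → ℕ := fun x => if x < i then x else x + 2
  let unskip : ℕ → ℕ := fun y => if y < i then y else y - 2
  let y := σ (skip x)
  if y = i then unskip (σ (i + 1)) else if y = i + 1 then unskip (σ i) else unskip y

/-- Insert the matching `τ` of `L` points in `σ`, just before the point `j` of `σ`. -/
def insertAt (j L : ℕ) (σ τ : ℕ → ℕ) (x : ℕ) : ℕ :=
  let shift : ℕ → ℕ := fun y => if y < j then y else y + L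
  if x < j then shift (σ x) else if x < j + L then τ (x - j) + j else shift (σ (x - L))

/-- Join the points `k + n - 1 - j` and `k + n + j` for all `j < n`, from the innermost pair to
the outermost one. -/
def closeMany (k : ℕ) : ℕ → (ℕ → ℕ) → ℕ → ℕ
  | 0, σ => σ
  | n + 1, σ => closeMany k n (closeAt (k + n) σ)

/-- The number of closed components which appear in `closeMany`. -/
def loopsMany (k : ℕ) : ℕ → (ℕ → ℕ) → ℕ
  | 0, _ => 0
  | n + 1, σ => (if σ (k + n) = k + n + 1 then 1 else 0) + loopsMany k n (closeAt (k + n) σ)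

/-- Where the partner of a point after closing comes from. -/
theorem closeAt_spec {i : ℕ} {σ : ℕ → ℕ} (h3 : ∀ x, σ (σ x) = x) (hi : σ i ≠ i)
    (hi' : σ (i + 1) ≠ i + 1) (x : ℕ) :
    ∃ X Y, (X = if x < i then x else x + 2) ∧
      (Y = if closeAt i σ x < i then closeAt i σ x else closeAt i σ x + 2) ∧
      ((σ X = Y ∧ σ Y = X) ∨ (σ X = i ∧ σ i = X ∧ σ (i + 1) = Y ∧ σ Y = i + 1) ∨
        (σ X = i + 1 ∧ σ (i + 1) = X ∧ σ i = Y ∧ σ Y = i)) := by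
  have key : ∀ y, y ≠ i → y ≠ i + 1 →
      y = if (if y < i then y else y - 2) < i then (if y < i then y else y - 2)
        else (if y < i then y else y - 2) + 2 := by
    intro y _ _; split_ifs <;> omega
  obtain ⟨X, hX⟩ : ∃ X, X = if x < i then x else x + 2 := ⟨_, rfl⟩
  have hXi : X ≠ i ∧ X ≠ i + 1 := by rw [hX]; split <;> omega
  have inj : ∀ a b, σ a = b → σ b = a := fun a b h => h ▸ h3 a
  by_cases c1 : σ X = i
  · have d := inj _ _ c1
    refine ⟨X, σ (i + 1), hX, ?_, Or.inr (Or.inl ⟨c1, d, rfl, h3 _⟩)⟩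
    have : closeAt i σ x = if σ (i + 1) < i then σ (i + 1) else σ (i + 1) - 2 := by
      simp [closeAt, ← hX, c1]
    rw [this]
    exact key _ (fun h => by have := inj _ _ h; omega) hi'
  by_cases c2 : σ X = i + 1
  · have d := inj _ _ c2
    refine ⟨X, σ i, hX, ?_, Or.inr (Or.inr ⟨c2, d, rfl, h3 _⟩)⟩
    have : closeAt i σ x = if σ i < i then σ i else σ i - 2 := by
      simp [closeAt, ← hX, c2]
    rw [this]
    exact key _ hi (fun h => by have := inj _ _ h; omega)
  · refine ⟨X, σ X, hX, ?_, Or.inl ⟨rfl, h3 _⟩⟩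
    have : closeAt i σ x = if σ X < i then σ X else σ X - 2 := by
      simp [closeAt, ← hX, c1, c2]
    rw [this]
    exact key _ c1 c2

theorem closeAt_isPlanar {N i : ℕ} {σ : ℕ → ℕ} (h : IsPlanarMatching (N + 2) σ) (hi : i ≤ N) :
    IsPlanarMatching N (closeAt i σ) := by
  obtain ⟨h1, h2, h3, h4⟩ := h
  have a1 := h2 i (by omega)
  have a2 := h2 (i + 1) (by omega)
  have spec := closeAt_spec h3 a1.2 a2.2
  refine ⟨fun x hx => ?_, fun x hx => ?_, fun x => ?_, fun x y hxy hy => ?_⟩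
  · obtain ⟨X, Y, hX, hY, hs⟩ := spec x
    have := h1 X (by rw [hX]; split <;> omega)
    split_ifs at hX hY <;> omega
  · obtain ⟨X, Y, hX, hY, hs⟩ := spec x
    have := h2 X (by rw [hX]; split <;> omega)
    have := h2 Y
    have b1 := h3 i
    have hYX : Y ≠ X := by
      rintro rfl
      omega
    have hYN : Y < N + 2 := by omega
    split_ifs at hX hY <;> omega
  · obtain ⟨X, Y, hX, hY, hs⟩ := spec x
    obtain ⟨X', Y', hX', hY', hs'⟩ := spec (closeAt i σ x)
    have hXY : X' = Y := by rw [hX', hY]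
    subst hXY
    have n1 : X ≠ i ∧ X ≠ i + 1 := by split_ifs at hX <;> omega
    have n2 : X' ≠ i ∧ X' ≠ i + 1 := by split_ifs at hX' <;> omega
    have n3 : Y' ≠ i ∧ Y' ≠ i + 1 := by split_ifs at hY' <;> omega
    have : Y' = X := by
      clear hX hY hX' hY' spec
      rcases hs with ⟨e1, e2⟩ | ⟨e1, e2, e3, e4⟩ | ⟨e1, e2, e3, e4⟩ <;>
      rcases hs' with ⟨f1, f2⟩ | ⟨f1, f2, f3, f4⟩ | ⟨f1, f2, f3, f4⟩ <;> omega
    split_ifs at hX hY' <;> omega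
  · obtain ⟨X, Y, hX, hY, hs⟩ := spec x
    obtain ⟨X', Y', hX', hY', hs'⟩ := spec y
    have l1 : X < X' := by split_ifs at hX hX' <;> omega
    have l2 : X' < Y := by split_ifs at hY hX' <;> omega
    have l3 : X < Y' ∧ Y' < Y := by
      have n1 : X ≠ i ∧ X ≠ i + 1 := by split_ifs at hX <;> omega
      have n2 : Y ≠ i ∧ Y ≠ i + 1 := by split_ifs at hY <;> omega
      have n3 : X' ≠ i ∧ X' ≠ i + 1 := by split_ifs at hX' <;> omega
      have n4 : Y' ≠ i ∧ Y' ≠ i + 1 := by split_ifs at hY' <;> omega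
      clear hX hY hX' hY' hy hxy h1 h2 spec
      rcases hs with ⟨e1, e2⟩ | ⟨e1, e2, e3, e4⟩ | ⟨e1, e2, e3, e4⟩ <;>
      rcases hs' with ⟨f1, f2⟩ | ⟨f1, f2, f3, f4⟩ | ⟨f1, f2, f3, f4⟩
      · have := h4 X X'; omega
      · have := h4 X X'; have := h4 X (i + 1); have := h4 X i; omega
      · have := h4 X X'; have := h4 X (i + 1); have := h4 X i; omega
      · have := h4 X X'; have := h4 (i + 1) X'; have := h4 X Y; have := h4 i (i + 1); omega
      · omega
      · omega
      · have := h4 X X'; have := h4 X i; have := h4 X' Y; have := h4 i X'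
        have := h4 (i + 1) Y'
        have : Y' ≠ X := by
          rintro rfl
          omega
        have : Y' ≠ Y := by
          rintro rfl
          omega
        omega
      · omega
      · omega
    split_ifs at hX hY hY' hX' <;> omega

theorem insertAt_isPlanar {N L j : ℕ} {σ τ : ℕ → ℕ} (hσ : IsPlanarMatching N σ)
    (hτ : IsPlanarMatching L τ) (hj : j ≤ N) : IsPlanarMatching (N + L) (insertAt j L σ τ) := by
  obtain ⟨h1, h2, h3, h4⟩ := hσ
  obtain ⟨k1, k2, k3, k4⟩ := hτ
  have kL : ∀ x, x < L → τ x < L := fun x hx => (k2 x hx).1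
  clear k1
  refine ⟨fun x hx => ?_, fun x hx => ?_, fun x => ?_, fun x y hxy => ?_⟩
  · have := h1 (x - L) (by omega)
    grind [insertAt]
  · simp only [insertAt]
    have := h2 x
    have := h2 (x - L)
    have := k2 (x - j)
    clear h1 h2 h3 h4 k2 k3 k4 kL
    grind
  · have := kL (x - j)
    have := k3 (x - j)
    have := h3 x
    have := h3 (x - L)
    have e : ∀ a, a + j - j = a := by omega
    have e' : ∀ a, a + L - L = a := by omega
    clear h1 h2 h3 h4 k2 k3 k4 kL
    simp only [insertAt]
    split_ifs <;> first | omega | grind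
  · have a1 := h4 x y
    have a2 := h4 (x - L) (y - L)
    have a3 := h4 x (y - L)
    have a4 := k4 (x - j) (y - j)
    have := kL (x - j)
    have := kL (y - j)
    clear h1 h2 h3 h4 k2 k3 k4 kL
    simp only [insertAt]
    split_ifs <;> omega

theorem closeMany_isPlanar {k m : ℕ} : ∀ {n : ℕ} {σ : ℕ → ℕ},
    IsPlanarMatching (k + n + (n + m)) σ → IsPlanarMatching (k + m) (closeMany k n σ)
  | 0, σ, h => by simpa [closeMany] using h
  | n + 1, σ, h => by
    refine closeMany_isPlanar (n := n) (closeAt_isPlanar ?_ (by omega))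
    rwa [show k + n + (n + m) + 2 = k + (n + 1) + (n + 1 + m) by omega]

/-- Juxtaposition of the boundary words of `v` (an `(n, k)`-tangle) and `u` (an
`(m, n)`-tangle): the bottom endpoints of `v` face the top endpoints of `u`. -/
def stack {k n m : ℕ} (v : PlanarMatching (k + n)) (u : PlanarMatching (n + m)) : ℕ → ℕ :=
  insertAt (k + n) (n + m) v.1 u.1

/-- The matching obtained by gluing `v` on top of `u` and forgetting the closed components. -/
def glue {k n m : ℕ} (v : PlanarMatching (k + n)) (u : PlanarMatching (n + m)) :
    PlanarMatching (k + m) :=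
  ⟨closeMany k n (stack v u), closeMany_isPlanar (insertAt_isPlanar v.2 u.2 le_rfl)⟩

/-- The number of closed components created when gluing `v` on top of `u`. -/
def loops {k n m : ℕ} (v : PlanarMatching (k + n)) (u : PlanarMatching (n + m)) : ℕ :=
  loopsMany k n (stack v u)

/-- The horizontal juxtaposition, with the `(m, n)`-tangle `u` on the left of the
`(m', n')`-tangle `v`. -/
def juxt {m n m' n' : ℕ} (u : PlanarMatching (n + m)) (v : PlanarMatching (n' + m')) :
    PlanarMatching (n + n' + (m + m')) :=
  ⟨insertAt n (n' + m') u.1 v.1, by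
    rw [show n + n' + (m + m') = n + m + (n' + m') by omega]
    exact insertAt_isPlanar u.2 v.2 (Nat.le_add_right n m)⟩

/-- `s` nested arcs. As an `(s, s)`-tangle this consists of `s` vertical strands. -/
def nested (s : ℕ) : PlanarMatching (s + s) :=
  ⟨fun x => if x < s + s then s + s - 1 - x else x, by
    refine ⟨fun x hx => ?_, fun x hx => ?_, fun x => ?_, fun x y hxy hy => ?_⟩ <;> grind⟩

end PlanarMatching

/-! ## The Temperley–Lieb category over a commutative ring -/

/-- Morphisms from `m` to `n`: linear combinations of planar `(m, n)`-tangles without closed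
components (a closed component is replaced by the scalar `δ` which enters `TLHom.comp`). -/
abbrev TLHom (R : Type) [CommRing R] (m n : ℕ) : Type := PlanarMatching (n + m) →₀ R

namespace TLHom

variable {R : Type} [CommRing R]

/-- The morphism given by `s` vertical strands. -/
def id (R : Type) [CommRing R] (s : ℕ) : TLHom R s s := Finsupp.single (PlanarMatching.nested s) 1

/-- `s` nested cups. -/
def cups (R : Type) [CommRing R] (s : ℕ) : TLHom R 0 (s + s) :=
  Finsupp.single (PlanarMatching.nested s) 1

/-- `s` nested caps. -/
def caps (R : Type) [CommRing R] (s : ℕ) : TLHom R (s + s) 0 :=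
  Finsupp.single ⟨(PlanarMatching.nested s).1, by
    rw [Nat.zero_add]; exact (PlanarMatching.nested s).2⟩ 1

/-- Vertical gluing, `v` on top of `u`, where every closed component counts for `δ`. -/
def comp (δ : R) {m n k : ℕ} (v : TLHom R n k) (u : TLHom R m n) : TLHom R m k :=
  v.sum fun d a => u.sum fun e b =>
    Finsupp.single (PlanarMatching.glue d e) (a * b * δ ^ PlanarMatching.loops d e)

/-- Horizontal juxtaposition, `u` on the left of `v`. -/
def tensor {m n m' n' : ℕ} (u : TLHom R m n) (v : TLHom R m' n') : TLHom R (m + m') (n + n') :=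
  u.sum fun d a => v.sum fun e b => Finsupp.single (PlanarMatching.juxt d e) (a * b)

/-- Transport along equalities of objects. -/
def cast {m n m' n' : ℕ} (hm : m = m') (hn : n = n') (t : TLHom R m n) : TLHom R m' n' :=
  hm ▸ hn ▸ t

end TLHom

/-! ## Jones–Wenzl idempotents -/

section JonesWenzl

variable {K : Type} [Field K]

/-- The quantum integer `[k]_A`. -/
def qInt (A : K) (k : ℕ) : K := (A ^ (2 * k) - (A ^ (2 * k))⁻¹) / (A ^ 2 - (A ^ 2)⁻¹)

/-- The value `-[2]_A` of a closed component. -/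
def loopValue (A : K) : K := -qInt A 2

/-- The simple Jones–Wenzl idempotents
`f_m = f_{m-1} ⊗ id_1 + ([m-1] / [m]) (f_{m-1} ⊗ id_1) (id_{m-2} ⊗ cup cap) (f_{m-1} ⊗ id_1)`. -/
def jonesWenzl (A : K) : (m : ℕ) → TLHom K m m
  | 0 => TLHom.id K 0
  | 1 => TLHom.id K 1
  | m + 2 =>
    let F : TLHom K (m + 2) (m + 2) := (jonesWenzl A (m + 1)).tensor (TLHom.id K 1)
    let e : TLHom K (m + 2) (m + 2) := (TLHom.id K m).tensor
      (TLHom.comp (loopValue A) (TLHom.cups K 1) (TLHom.caps K 1))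
    F + (qInt A (m + 1) / qInt A (m + 2)) •
      TLHom.comp (loopValue A) F (TLHom.comp (loopValue A) e F)

/-- The endomorphism
`h_m = (-1)^m [2r-m-1] (f_{r-1} ⊗ id_s) (id_{2r-m-2} ⊗ cups_s caps_s) (f_{r-1} ⊗ id_s)`
for `r ≤ m ≤ 2r-2`, where `s = m - r + 1`. -/
def hMor (A : K) (r m : ℕ) (h₁ : r ≤ m) (h₂ : m + 2 ≤ 2 * r) : TLHom K m m :=
  let s := m + 1 - r
  let F : TLHom K m m := TLHom.cast (by omega) (by omega)
    ((jonesWenzl A (r - 1)).tensor (TLHom.id K s))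
  let e : TLHom K m m := TLHom.cast (by omega) (by omega)
    ((TLHom.id K (2 * r - m - 2)).tensor
      (TLHom.comp (loopValue A) (TLHom.cups K s) (TLHom.caps K s)))
  ((-1) ^ m * qInt A (2 * r - m - 1)) •
    TLHom.comp (loopValue A) F (TLHom.comp (loopValue A) e F)

/-- `g_m = f_m + [r]⁻¹ h_m` for `r ≤ m ≤ 2r-2`. -/
def gMor (A : K) (r m : ℕ) (h₁ : r ≤ m) (h₂ : m + 2 ≤ 2 * r) : TLHom K m m :=
  jonesWenzl A m + (qInt A r)⁻¹ • hMor A r m h₁ h₂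

end JonesWenzl

/-! ## Specialization at `A = q^((r+1)/2)`, `q = exp (2πi/r)` -/

/-- The complex number `q^((r+1)/2)` with `q = exp (2πi/r)`, for odd `r`. -/
def specialA (r : ℕ) : ℂ := Complex.exp (2 * Real.pi * Complex.I / r) ^ ((r + 1) / 2)

/-- All the coefficients of `x` are regular (have no pole) at `a`. -/
def TLHom.RegularAt (a : ℂ) {m n : ℕ} (x : TLHom (RatFunc ℂ) m n) : Prop :=
  ∀ d, (x d).denom.eval a ≠ 0

/-- Evaluation of the coefficients of `x` at `a`; meaningful if they are regular there. -/
def TLHom.specialize (a : ℂ) {m n : ℕ} (x : TLHom (RatFunc ℂ) m n) : TLHom ℂ m n :=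
  Finsupp.mapRange (RatFunc.eval (RingHom.id ℂ) a) (RatFunc.eval_zero _ _) x

/-- `f_m` in the generic Temperley–Lieb category, over the field `ℂ(A)`. -/
def fGen (m : ℕ) : TLHom (RatFunc ℂ) m m := jonesWenzl RatFunc.X m

/-- In the generic Temperley–Lieb category, `f_m` for `m ≤ r-1` and `g_m` for `r ≤ m ≤ 2r-2`. -/
def tGen (r m : ℕ) (hm : m < 2 * r - 1) : TLHom (RatFunc ℂ) m m :=
  if h : r ≤ m then gMor RatFunc.X r m h (by omega) else fGen m

/-- `f_m` in the specialized Temperley–Lieb category (used for `m = r-1` and `m = 2r-1`). -/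
def fSpec (r m : ℕ) : TLHom ℂ m m := (fGen m).specialize (specialA r)

/-- The idempotent `t_m` in the specialized Temperley–Lieb category. -/
def tSpec (r m : ℕ) (hm : m < 2 * r - 1) : TLHom ℂ m m := (tGen r m hm).specialize (specialA r)

/-! ## The extended Temperley–Lieb category

The strict monoidal linear category generated by the specialized Temperley–Lieb category and by
morphisms `p^±` and `i^±`, subject to relations. -/

/-- Formal expressions for the morphisms of the extended Temperley–Lieb category. The sign `+` is
encoded by `true`, and `-` by `false`. -/
inductive ExtTerm (r : ℕ) : ℕ → ℕ → Type
  | ofTL {m n : ℕ} (t : TLHom ℂ m n) : ExtTerm r m n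
  | p (ε : Bool) : ExtTerm r (2 * r - 1) (r - 1)
  | i (ε : Bool) : ExtTerm r (r - 1) (2 * r - 1)
  | comp {m n k : ℕ} (v : ExtTerm r n k) (u : ExtTerm r m n) : ExtTerm r m k
  | tensor {m n m' n' : ℕ} (u : ExtTerm r m n) (v : ExtTerm r m' n') :
      ExtTerm r (m + m') (n + n')
  | add {m n : ℕ} (u v : ExtTerm r m n) : ExtTerm r m n
  | smul {m n : ℕ} (c : ℂ) (u : ExtTerm r m n) : ExtTerm r m n

namespace ExtTerm

variable {r : ℕ}

/-- Transport along equalities of objects. -/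
def cast {m n m' n' : ℕ} (hm : m = m') (hn : n = n') (t : ExtTerm r m n) : ExtTerm r m' n' :=
  hm ▸ hn ▸ t

/-- The identity of `m`. -/
def id (r m : ℕ) : ExtTerm r m m := ofTL (TLHom.id ℂ m)

/-- The idempotent `f_m`, for `m = r-1` and `m = 2r-1`. -/
def f (r m : ℕ) : ExtTerm r m m := ofTL (fSpec r m)

/-- The cup. -/
def cup (r : ℕ) : ExtTerm r 0 2 := ofTL (TLHom.cups ℂ 1)

/-- The cap. -/
def cap (r : ℕ) : ExtTerm r 2 0 := ofTL (TLHom.caps ℂ 1)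

/-- The relations: a congruence containing the laws of a strict monoidal linear category, the
functoriality of the inclusion of the Temperley–Lieb category, and the defining relations of
`p^±` and `i^±`. -/
inductive Rel (r : ℕ) : {m n : ℕ} → ExtTerm r m n → ExtTerm r m n → Prop
  -- congruence
  | comp_left {m n k : ℕ} {v v' : ExtTerm r n k} (u : ExtTerm r m n) :
      Rel r v v' → Rel r (comp v u) (comp v' u)
  | comp_right {m n k : ℕ} (v : ExtTerm r n k) {u u' : ExtTerm r m n} :
      Rel r u u' → Rel r (comp v u) (comp v u')
  | tensor_left {m n m' n' : ℕ} {u u' : ExtTerm r m n} (v : ExtTerm r m' n') :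
      Rel r u u' → Rel r (tensor u v) (tensor u' v)
  | tensor_right {m n m' n' : ℕ} (u : ExtTerm r m n) {v v' : ExtTerm r m' n'} :
      Rel r v v' → Rel r (tensor u v) (tensor u v')
  | add_left {m n : ℕ} {u u' : ExtTerm r m n} (v : ExtTerm r m n) :
      Rel r u u' → Rel r (add u v) (add u' v)
  | add_right {m n : ℕ} (u : ExtTerm r m n) {v v' : ExtTerm r m n} :
      Rel r v v' → Rel r (add u v) (add u v')
  | smul_congr {m n : ℕ} (c : ℂ) {u u' : ExtTerm r m n} :
      Rel r u u' → Rel r (smul c u) (smul c u')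
  -- morphisms form complex vector spaces
  | add_assoc {m n : ℕ} (u v w : ExtTerm r m n) : Rel r (add (add u v) w) (add u (add v w))
  | add_comm {m n : ℕ} (u v : ExtTerm r m n) : Rel r (add u v) (add v u)
  | zero_add {m n : ℕ} (u : ExtTerm r m n) : Rel r (add (ofTL 0) u) u
  | one_smul {m n : ℕ} (u : ExtTerm r m n) : Rel r (smul 1 u) u
  | zero_smul {m n : ℕ} (u : ExtTerm r m n) : Rel r (smul 0 u) (ofTL 0)
  | mul_smul {m n : ℕ} (c c' : ℂ) (u : ExtTerm r m n) :
      Rel r (smul (c * c') u) (smul c (smul c' u))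
  | add_smul {m n : ℕ} (c c' : ℂ) (u : ExtTerm r m n) :
      Rel r (smul (c + c') u) (add (smul c u) (smul c' u))
  | smul_add {m n : ℕ} (c : ℂ) (u v : ExtTerm r m n) :
      Rel r (smul c (add u v)) (add (smul c u) (smul c v))
  -- laws of a linear category
  | comp_assoc {m n k l : ℕ} (w : ExtTerm r k l) (v : ExtTerm r n k) (u : ExtTerm r m n) :
      Rel r (comp (comp w v) u) (comp w (comp v u))
  | id_comp {m n : ℕ} (u : ExtTerm r m n) : Rel r (comp (id r n) u) u
  | comp_id {m n : ℕ} (u : ExtTerm r m n) : Rel r (comp u (id r m)) u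
  | add_comp {m n k : ℕ} (v v' : ExtTerm r n k) (u : ExtTerm r m n) :
      Rel r (comp (add v v') u) (add (comp v u) (comp v' u))
  | comp_add {m n k : ℕ} (v : ExtTerm r n k) (u u' : ExtTerm r m n) :
      Rel r (comp v (add u u')) (add (comp v u) (comp v u'))
  | smul_comp {m n k : ℕ} (c : ℂ) (v : ExtTerm r n k) (u : ExtTerm r m n) :
      Rel r (comp (smul c v) u) (smul c (comp v u))
  | comp_smul {m n k : ℕ} (c : ℂ) (v : ExtTerm r n k) (u : ExtTerm r m n) :
      Rel r (comp v (smul c u)) (smul c (comp v u))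
  -- laws of a strict monoidal linear structure
  | tensor_assoc {m n m' n' m'' n'' : ℕ} (u : ExtTerm r m n) (v : ExtTerm r m' n')
      (w : ExtTerm r m'' n'') :
      Rel r (cast (Nat.add_assoc m m' m'') (Nat.add_assoc n n' n'') (tensor (tensor u v) w))
        (tensor u (tensor v w))
  | id_zero_tensor {m n : ℕ} (u : ExtTerm r m n) :
      Rel r (cast (Nat.zero_add m) (Nat.zero_add n) (tensor (id r 0) u)) u
  | tensor_id_zero {m n : ℕ} (u : ExtTerm r m n) : Rel r (tensor u (id r 0)) u
  | interchange {m n k m' n' k' : ℕ} (v : ExtTerm r n k) (u : ExtTerm r m n)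
      (v' : ExtTerm r n' k') (u' : ExtTerm r m' n') :
      Rel r (tensor (comp v u) (comp v' u')) (comp (tensor v v') (tensor u u'))
  | add_tensor {m n m' n' : ℕ} (u u' : ExtTerm r m n) (v : ExtTerm r m' n') :
      Rel r (tensor (add u u') v) (add (tensor u v) (tensor u' v))
  | tensor_add {m n m' n' : ℕ} (u : ExtTerm r m n) (v v' : ExtTerm r m' n') :
      Rel r (tensor u (add v v')) (add (tensor u v) (tensor u v'))
  | smul_tensor {m n m' n' : ℕ} (c : ℂ) (u : ExtTerm r m n) (v : ExtTerm r m' n') :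
      Rel r (tensor (smul c u) v) (smul c (tensor u v))
  | tensor_smul {m n m' n' : ℕ} (c : ℂ) (u : ExtTerm r m n) (v : ExtTerm r m' n') :
      Rel r (tensor u (smul c v)) (smul c (tensor u v))
  -- the inclusion of the Temperley–Lieb category is a monoidal linear functor
  | ofTL_add {m n : ℕ} (s t : TLHom ℂ m n) : Rel r (ofTL (s + t)) (add (ofTL s) (ofTL t))
  | ofTL_smul {m n : ℕ} (c : ℂ) (t : TLHom ℂ m n) : Rel r (ofTL (c • t)) (smul c (ofTL t))
  | ofTL_comp {m n k : ℕ} (t : TLHom ℂ n k) (s : TLHom ℂ m n) :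
      Rel r (ofTL (TLHom.comp (loopValue (specialA r)) t s)) (comp (ofTL t) (ofTL s))
  | ofTL_tensor {m n m' n' : ℕ} (s : TLHom ℂ m n) (t : TLHom ℂ m' n') :
      Rel r (ofTL (s.tensor t)) (tensor (ofTL s) (ofTL t))
  -- `p^±` is a morphism from `f_{2r-1}` to `f_{r-1}`, and `i^±` is one in the other direction
  | p_f (ε : Bool) : Rel r (comp (p ε) (f r (2 * r - 1))) (p ε)
  | f_p (ε : Bool) : Rel r (comp (f r (r - 1)) (p ε)) (p ε)
  | i_f (ε : Bool) : Rel r (comp (i ε) (f r (r - 1))) (i ε)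
  | f_i (ε : Bool) : Rel r (comp (f r (2 * r - 1)) (i ε)) (i ε)
  -- `(id_m ⊗ p^ε) (i^ε' ⊗ id_m) = δ_{ε,ε'} (id_m ⊗ f_{r-1}) (f_{r-1} ⊗ id_m)`
  | p_i_left (m : ℕ) (hm : m ≤ r - 1) (ε ε' : Bool) :
      Rel r
        (comp (tensor (id r m) (p ε))
          (cast rfl (Nat.add_comm (2 * r - 1) m) (tensor (i ε') (id r m))))
        (smul (if ε = ε' then 1 else 0)
          (comp (tensor (id r m) (f r (r - 1)))
            (cast rfl (Nat.add_comm (r - 1) m) (tensor (f r (r - 1)) (id r m)))))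
  -- `(p^ε ⊗ id_m) (id_m ⊗ i^ε') = δ_{ε,ε'} (f_{r-1} ⊗ id_m) (id_m ⊗ f_{r-1})`
  | p_i_right (m : ℕ) (hm : m ≤ r - 1) (ε ε' : Bool) :
      Rel r
        (comp (tensor (p ε) (id r m))
          (cast rfl (Nat.add_comm m (2 * r - 1)) (tensor (id r m) (i ε'))))
        (smul (if ε = ε' then 1 else 0)
          (comp (tensor (f r (r - 1)) (id r m))
            (cast rfl (Nat.add_comm m (r - 1)) (tensor (id r m) (f r (r - 1))))))
  -- `∑_ε (id_m ⊗ i^ε) (p^ε ⊗ id_m) = (id_m ⊗ f_{2r-1}) (f_{2r-1} ⊗ id_m)`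
  | i_p_left (m : ℕ) (hm : m ≤ r - 1) :
      Rel r
        (add
          (comp (tensor (id r m) (i true))
            (cast rfl (Nat.add_comm (r - 1) m) (tensor (p true) (id r m))))
          (comp (tensor (id r m) (i false))
            (cast rfl (Nat.add_comm (r - 1) m) (tensor (p false) (id r m)))))
        (comp (tensor (id r m) (f r (2 * r - 1)))
          (cast rfl (Nat.add_comm (2 * r - 1) m) (tensor (f r (2 * r - 1)) (id r m))))
  -- `∑_ε (i^ε ⊗ id_m) (id_m ⊗ p^ε) = (f_{2r-1} ⊗ id_m) (id_m ⊗ f_{2r-1})`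
  | i_p_right (m : ℕ) (hm : m ≤ r - 1) :
      Rel r
        (add
          (comp (tensor (i true) (id r m))
            (cast rfl (Nat.add_comm m (r - 1)) (tensor (id r m) (p true))))
          (comp (tensor (i false) (id r m))
            (cast rfl (Nat.add_comm m (r - 1)) (tensor (id r m) (p false)))))
        (comp (tensor (f r (2 * r - 1)) (id r m))
          (cast rfl (Nat.add_comm m (2 * r - 1)) (tensor (id r m) (f r (2 * r - 1)))))
  -- `(id_{2r-2} ⊗ cap) (i^ε ⊗ id_1) = -(cap ⊗ id_{2r-2}) (id_1 ⊗ i^ε)`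
  | i_cap (hr : 1 ≤ r) (ε : Bool) :
      Rel r
        (comp (tensor (id r (2 * r - 2)) (cap r))
          (cast (show r - 1 + 1 = r by omega) (show 2 * r - 1 + 1 = 2 * r - 2 + 2 by omega)
            (tensor (i ε) (id r 1))))
        (smul (-1)
          (cast rfl (Nat.zero_add (2 * r - 2))
            (comp (tensor (cap r) (id r (2 * r - 2)))
              (cast (show 1 + (r - 1) = r by omega)
                (show 1 + (2 * r - 1) = 2 + (2 * r - 2) by omega)
                (tensor (id r 1) (i ε))))))
  -- `(p^ε ⊗ id_1) (id_{2r-2} ⊗ cup) = -(id_1 ⊗ p^ε) (cup ⊗ id_{2r-2})`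
  | p_cup (hr : 1 ≤ r) (ε : Bool) :
      Rel r
        (comp
          (cast (show 2 * r - 1 + 1 = 2 * r - 2 + 2 by omega) (show r - 1 + 1 = r by omega)
            (tensor (p ε) (id r 1)))
          (tensor (id r (2 * r - 2)) (cup r)))
        (smul (-1)
          (cast (Nat.zero_add (2 * r - 2)) rfl
            (comp
              (cast (show 1 + (2 * r - 1) = 2 + (2 * r - 2) by omega)
                (show 1 + (r - 1) = r by omega)
                (tensor (id r 1) (p ε)))
              (tensor (cup r) (id r (2 * r - 2))))))

end ExtTerm

/-- Objects of the extended Temperley–Lieb category: the natural numbers. -/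
structure ExtTL (r : ℕ) : Type where
  /-- the underlying number of points -/
  pts : ℕ

/-- Morphisms of the extended Temperley–Lieb category: formal expressions modulo the equivalence
relation generated by the relations. -/
def ExtHom (r m n : ℕ) : Type := Quot (fun u v : ExtTerm r m n => ExtTerm.Rel r u v)

namespace ExtHom

variable {r m n k : ℕ}

/-- The morphism represented by a formal expression. -/
def mk (u : ExtTerm r m n) : ExtHom r m n := Quot.mk _ u

/-- The image of a morphism of the Temperley–Lieb category. -/
def ofTL (r : ℕ) (t : TLHom ℂ m n) : ExtHom r m n := mk (ExtTerm.ofTL t)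

/-- Composition, `v` after `u`. -/
def comp (v : ExtHom r n k) (u : ExtHom r m n) : ExtHom r m k :=
  Quot.map₂ ExtTerm.comp (fun v _ _ h => .comp_right v h) (fun _ _ u h => .comp_left u h) v u

instance : Zero (ExtHom r m n) := ⟨ofTL r 0⟩

instance : Add (ExtHom r m n) :=
  ⟨Quot.map₂ ExtTerm.add (fun v _ _ h => .add_right v h) (fun _ _ u h => .add_left u h)⟩

instance : SMul ℂ (ExtHom r m n) :=
  ⟨fun c => Quot.map (ExtTerm.smul c) (fun _ _ h => .smul_congr c h)⟩

instance : AddCommMonoid (ExtHom r m n) where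
  add_assoc := by rintro ⟨u⟩ ⟨v⟩ ⟨w⟩; exact Quot.sound (.add_assoc u v w)
  add_comm := by rintro ⟨u⟩ ⟨v⟩; exact Quot.sound (.add_comm u v)
  zero_add := by rintro ⟨u⟩; exact Quot.sound (.zero_add u)
  add_zero := by
    rintro ⟨u⟩
    exact (Quot.sound (.add_comm u (.ofTL 0))).trans (Quot.sound (.zero_add u))
  nsmul := nsmulRec

theorem smul_zero' (c : ℂ) : c • (0 : ExtHom r m n) = 0 := by
  have h : ExtHom.ofTL r (c • (0 : TLHom ℂ m n)) = c • ExtHom.ofTL r (0 : TLHom ℂ m n) :=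
    Quot.sound (.ofTL_smul c 0)
  rw [smul_zero] at h
  exact h.symm

instance : Module ℂ (ExtHom r m n) where
  one_smul := by rintro ⟨u⟩; exact Quot.sound (.one_smul u)
  mul_smul := by rintro c c' ⟨u⟩; exact Quot.sound (.mul_smul c c' u)
  smul_zero := smul_zero'
  smul_add := by rintro c ⟨u⟩ ⟨v⟩; exact Quot.sound (.smul_add c u v)
  add_smul := by rintro c c' ⟨u⟩; exact Quot.sound (.add_smul c c' u)
  zero_smul := by rintro ⟨u⟩; exact Quot.sound (.zero_smul u)

instance : AddCommGroup (ExtHom r m n) := Module.addCommMonoidToAddCommGroup ℂ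

end ExtHom

instance (r : ℕ) : Category (ExtTL r) where
  Hom X Y := ExtHom r X.pts Y.pts
  id X := ExtHom.ofTL r (TLHom.id ℂ X.pts)
  comp u v := ExtHom.comp v u
  id_comp := by rintro X Y ⟨u⟩; exact Quot.sound (.comp_id u)
  comp_id := by rintro X Y ⟨u⟩; exact Quot.sound (.id_comp u)
  assoc := by rintro X Y Z W ⟨u⟩ ⟨v⟩ ⟨w⟩; exact (Quot.sound (.comp_assoc w v u)).symm

instance (r : ℕ) : Preadditive (ExtTL r) where
  homGroup X Y := inferInstanceAs (AddCommGroup (ExtHom r X.pts Y.pts))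
  add_comp := by rintro X Y Z ⟨u⟩ ⟨u'⟩ ⟨v⟩; exact Quot.sound (.comp_add v u u')
  comp_add := by rintro X Y Z ⟨u⟩ ⟨v⟩ ⟨v'⟩; exact Quot.sound (.add_comp v v' u)

instance (r : ℕ) : Linear ℂ (ExtTL r) where
  homModule X Y := inferInstanceAs (Module ℂ (ExtHom r X.pts Y.pts))
  smul_comp := by rintro X Y Z c ⟨u⟩ ⟨v⟩; exact Quot.sound (.comp_smul c v u)
  comp_smul := by rintro X Y Z ⟨u⟩ c ⟨v⟩; exact Quot.sound (.smul_comp c v u)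

/-- The idempotent `t_n` as an endomorphism of the object `n` of the extended category. -/
def ExtTL.t (r n : ℕ) (hn : n < 2 * r - 1) : (⟨n⟩ : ExtTL r) ⟶ ⟨n⟩ :=
  ExtHom.ofTL r (tSpec r n hn)

end

open CategoryTheory

noncomputable section

/-! ## Arc diagrams with loose ends -/

/-! Write R = r - 1. There are two independent halves: regularity, and the decomposition of
identities.

Regularity. Gluing matchings is awkward to reassociate, so a tangle is read as an arc diagram on a
half-line, top endpoints first, and the free module on arc diagrams is acted on by operators `cup i`
and `cap i`, whose product is associative for free. They satisfy the Temperley–Lieb relations, and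
by `IsTangle.emb_comp` a tangle obtained by applying such an operator T to the identity acts by
composition as T. Strands added on the right do not affect T, so f_n becomes one operator `jw A n`
for any number of strands, and g_n with n = R + s becomes `jwBent A R s`. Write H_n = h_n/[r]. The
summands f_n and H_n may each have a pole where [r] = 0, but the poles cancel: g_r is f_{r-1} ⊗ id_1
(`jwBent_one`), g_{r+1} has an explicit formula without 1/[r] (`jwBent_two`), and after that
`jwBent_succ` says g_{n+1} = g_n + ([n]/[n+1]) g_n e g_n + ([2r]/([n+1][2r-n])) (H_{n+1} - H_n),
where extra strands are suppressed and e is a cup-cap. The factor [2r]/[r] = A^{2r} + A^{-2r}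
absorbs the pole of H. For n + 1 = 2r - 1 the coefficient of H_{n+1} contains [0], so the recursion
ends at f_{2r-1} itself. The remaining denominators are [k] with 0 < k < 2r and k ≠ r; they do not
vanish at the special point, because A² = q there and r is odd.

Decomposition. By strong induction on m, id_m lies in the span `factoring` of the endomorphisms
which factor through some t_n. In t_m and f_m the identity has coefficient 1, and every other
diagram has an arc between neighbouring top points, hence factors through m - 2. This settles m ≤ 2r
- 2. For m = 2r - 1, let f = f_{2r-1}: the relation ff = ∑ i^ε p^ε factors ff through r - 1, and id
= ff - f(f - id) - (f - id). For m = 2r - 1 + l, tensor the decomposition of id_{2r-1} with id_l;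
its terms factor through n + l < m points. -/

/-- Involutions of `ℕ`, thought of as arc diagrams on a half-infinite line whose fixed points are
loose ends. -/
def ArcDiagram : Type := {σ : ℕ → ℕ // ∀ x, σ (σ x) = x}

namespace ArcDiagram

/-- Renumber the points to make room for `L` new ones, just before the point `i`. -/
def skip (i L x : ℕ) : ℕ := if x < i then x else x + L

/-- The partner of `x ≠ p, p'` once the points `p` and `p'` of `σ` are joined. -/
def join (p p' : ℕ) (σ : ℕ → ℕ) (x : ℕ) : ℕ :=
  let z := if σ x = p then σ p' else if σ x = p' then σ p else σ x
  -- The path from `x` can end at a joined point only if that point was a loose end; `x` then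
  -- becomes a loose end.
  if z = p ∨ z = p' then x else z

/-- Join the points `i` and `i + 1`, remove them and renumber the others. -/
def capFun (i : ℕ) (σ : ℕ → ℕ) (x : ℕ) : ℕ :=
  let z := join i (i + 1) σ (skip i 2 x)
  if z < i then z else z - 2

/-- Insert an arc just before the point `i`. -/
def cupFun (i : ℕ) (σ : ℕ → ℕ) (x : ℕ) : ℕ :=
  if x < i then skip i 2 (σ x) else
    if x = i then i + 1 else if x = i + 1 then i else skip i 2 (σ (x - 2))

theorem skip_injective (i L : ℕ) : Function.Injective (skip i L) := by
  intro x y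
  unfold skip
  split_ifs <;> omega

theorem skip_ne (i x : ℕ) : skip i 2 x ≠ i ∧ skip i 2 x ≠ i + 1 := by
  unfold skip
  split_ifs <;> omega

theorem skip_skip {i j : ℕ} (L L' : ℕ) (hij : i ≤ j) (x : ℕ) :
    skip i L (skip j L' x) = skip (j + L) L' (skip i L x) := by
  unfold skip
  split_ifs <;> omega

theorem eq_or_eq_skip (i x : ℕ) : x = i ∨ x = i + 1 ∨ ∃ y, x = skip i 2 y := by
  by_cases h : x < i
  · exact Or.inr (Or.inr ⟨x, by simp [skip, h]⟩)
  · by_cases h' : x < i + 2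
    · omega
    · exact Or.inr (Or.inr ⟨x - 2, by rw [skip, if_neg (by omega)]; omega⟩)

theorem join_ne {p p' : ℕ} {σ : ℕ → ℕ} {x : ℕ} (hx : x ≠ p ∧ x ≠ p') :
    join p p' σ x ≠ p ∧ join p p' σ x ≠ p' := by
  unfold join
  grind

theorem join_join {p p' : ℕ} {σ : ℕ → ℕ} (h : ∀ x, σ (σ x) = x) {x : ℕ}
    (hx : x ≠ p ∧ x ≠ p') : join p p' σ (join p p' σ x) = x := by
  have := h p
  have := h p'
  have := h x
  unfold join
  grind

theorem join_comm {p p' q q' : ℕ} {σ : ℕ → ℕ} (h : ∀ x, σ (σ x) = x) {x : ℕ}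
    (hx : x ≠ p ∧ x ≠ p') (hx' : x ≠ q ∧ x ≠ q') (h1 : p ≠ q) (h2 : p ≠ q') (h3 : p' ≠ q)
    (h4 : p' ≠ q') :
    join p p' (join q q' σ) x = join q q' (join p p' σ) x := by
  have := h p
  have := h p'
  have := h q
  have := h q'
  have := h x
  clear h
  unfold join
  grind

/-- This removes the renumbering: identities between `capFun`s are checked after applying the
injective map `skip`, where they become identities between `join`s. -/
theorem skip_capFun (i : ℕ) (σ : ℕ → ℕ) (x : ℕ) :
    skip i 2 (capFun i σ x) = join i (i + 1) σ (skip i 2 x) := by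
  have := join_ne (σ := σ) (skip_ne i x)
  unfold capFun
  simp only
  generalize join i (i + 1) σ (skip i 2 x) = z at *
  unfold skip
  split_ifs <;> omega

theorem cupFun_skip (i : ℕ) (σ : ℕ → ℕ) (x : ℕ) : cupFun i σ (skip i 2 x) = skip i 2 (σ x) := by
  unfold cupFun skip
  grind

theorem cupFun_self (i : ℕ) (σ : ℕ → ℕ) : cupFun i σ i = i + 1 := by
  simp [cupFun]

theorem cupFun_succ (i : ℕ) (σ : ℕ → ℕ) : cupFun i σ (i + 1) = i := by
  simp [cupFun]

theorem capFun_involutive {i : ℕ} {σ : ℕ → ℕ} (h : ∀ x, σ (σ x) = x) (x : ℕ) :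
    capFun i σ (capFun i σ x) = x := by
  apply skip_injective i 2
  rw [skip_capFun, skip_capFun, join_join h (skip_ne i x)]

theorem cupFun_involutive {i : ℕ} {σ : ℕ → ℕ} (h : ∀ x, σ (σ x) = x) (x : ℕ) :
    cupFun i σ (cupFun i σ x) = x := by
  obtain rfl | rfl | ⟨y, rfl⟩ := eq_or_eq_skip i x
  · rw [cupFun_self, cupFun_succ]
  · rw [cupFun_succ, cupFun_self]
  · rw [cupFun_skip, cupFun_skip, h]

theorem capFun_cupFun_self (i : ℕ) (σ : ℕ → ℕ) : capFun i (cupFun i σ) = σ := by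
  funext x
  apply skip_injective i 2
  rw [skip_capFun]
  have := skip_ne i (σ x)
  simp [join, cupFun_skip, this]

/-- A zigzag is straightened; this and `capFun_succ_cupFun` are the two snake relations. -/
theorem capFun_cupFun_succ {i : ℕ} {σ : ℕ → ℕ} (h : ∀ x, σ (σ x) = x) :
    capFun i (cupFun (i + 1) σ) = σ := by
  funext x
  have h1 := h i
  have h3 := h x
  unfold capFun cupFun skip join
  grind

theorem capFun_succ_cupFun {i : ℕ} {σ : ℕ → ℕ} (h : ∀ x, σ (σ x) = x) :
    capFun (i + 1) (cupFun i σ) = σ := by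
  funext x
  have h1 := h i
  have h3 := h x
  unfold capFun cupFun skip join
  grind

/-- Joining is natural under injective relabellings. Inserting or removing an arc and inserting a
matching all relabel by some `skip`, so their commutation with a distant joining comes from here. -/
theorem join_semiconj {p p' q q' : ℕ} {σ τ e : ℕ → ℕ} (he : Function.Injective e)
    (hτ : ∀ x, τ (e x) = e (σ x)) (hp : e p = q) (hp' : e p' = q') (x : ℕ) :
    join q q' τ (e x) = e (join p p' σ x) := by
  subst hp hp'
  simp only [join, hτ, he.eq_iff]
  split_ifs <;> simp_all [he.eq_iff]

theorem join_cupFun {p p' q q' i : ℕ} {σ : ℕ → ℕ} (hp : skip i 2 p = q) (hp' : skip i 2 p' = q')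
    (x : ℕ) : join q q' (cupFun i σ) (skip i 2 x) = skip i 2 (join p p' σ x) :=
  join_semiconj (skip_injective i 2) (cupFun_skip i σ) hp hp' x

theorem join_cupFun_self {q q' i : ℕ} {σ : ℕ → ℕ} (h1 : i ≠ q ∧ i ≠ q')
    (h2 : i + 1 ≠ q ∧ i + 1 ≠ q') :
    join q q' (cupFun i σ) i = i + 1 ∧ join q q' (cupFun i σ) (i + 1) = i := by
  simp [join, cupFun_self, cupFun_succ, h1, h2]

theorem capFun_cupFun_of_le {i j : ℕ} (hij : i ≤ j) (σ : ℕ → ℕ) :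
    capFun i (cupFun (j + 2) σ) = cupFun j (capFun i σ) := by
  funext x
  apply skip_injective i 2
  rw [skip_capFun]
  have e : skip i 2 j = j + 2 ∧ skip i 2 (j + 1) = j + 2 + 1 := by
    unfold skip; split_ifs <;> omega
  have := join_cupFun_self (q := i) (q' := i + 1) (i := j + 2) (σ := σ) (by omega) (by omega)
  obtain rfl | rfl | ⟨y, rfl⟩ := eq_or_eq_skip j x
  · rw [cupFun_self, e.1, e.2, this.1]
  · rw [cupFun_succ, e.1, e.2, this.2]
  · rw [cupFun_skip, skip_skip 2 2 hij, skip_skip 2 2 hij, skip_capFun]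
    exact join_cupFun (by simp [skip]; omega) (by simp [skip]; omega) _

theorem capFun_add_two_cupFun {i j : ℕ} (hij : i ≤ j) (σ : ℕ → ℕ) :
    capFun (j + 2) (cupFun i σ) = cupFun i (capFun j σ) := by
  funext x
  apply skip_injective (j + 2) 2
  rw [skip_capFun]
  have e : skip (j + 2) 2 i = i ∧ skip (j + 2) 2 (i + 1) = i + 1 := by
    unfold skip; split_ifs <;> omega
  have := join_cupFun_self (q := j + 2) (q' := j + 2 + 1) (i := i) (σ := σ) (by omega) (by omega)
  obtain rfl | rfl | ⟨y, rfl⟩ := eq_or_eq_skip i x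
  · rw [cupFun_self, e.1, e.2, this.1]
  · rw [cupFun_succ, e.1, e.2, this.2]
  · rw [cupFun_skip, ← skip_skip 2 2 hij, ← skip_skip 2 2 hij, skip_capFun]
    exact join_cupFun (by simp [skip]; omega) (by simp [skip]; omega) _

theorem cupFun_cupFun {i j : ℕ} (hij : i ≤ j) (σ : ℕ → ℕ) :
    cupFun i (cupFun j σ) = cupFun (j + 2) (cupFun i σ) := by
  funext x
  have e : skip i 2 j = j + 2 ∧ skip i 2 (j + 1) = j + 2 + 1 := by
    unfold skip; split_ifs <;> omega
  have e' : skip (j + 2) 2 i = i ∧ skip (j + 2) 2 (i + 1) = i + 1 := by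
    unfold skip; split_ifs <;> omega
  obtain rfl | rfl | ⟨y, rfl⟩ := eq_or_eq_skip i x
  · rw [cupFun_self]
    conv_rhs => rw [← e'.1, cupFun_skip, e'.1, cupFun_self, e'.2]
  · rw [cupFun_succ]
    conv_rhs => rw [← e'.2, cupFun_skip, cupFun_succ, e'.1]
  rw [cupFun_skip]
  obtain rfl | rfl | ⟨y, rfl⟩ := eq_or_eq_skip j y
  · rw [cupFun_self, e.1, e.2, cupFun_self]
  · rw [cupFun_succ, e.1, e.2, cupFun_succ]
  · rw [cupFun_skip, skip_skip 2 2 hij, skip_skip 2 2 hij, cupFun_skip, cupFun_skip]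

theorem join_capFun {p p' q q' j : ℕ} {σ : ℕ → ℕ} (hp : skip j 2 p = q) (hp' : skip j 2 p' = q')
    (x : ℕ) : skip j 2 (join p p' (capFun j σ) x) = join q q' (join j (j + 1) σ) (skip j 2 x) :=
  (join_semiconj (skip_injective j 2) (fun x => (skip_capFun j σ x).symm) hp hp' x).symm

theorem capFun_capFun {i j : ℕ} (hij : i ≤ j) {σ : ℕ → ℕ} (h : ∀ x, σ (σ x) = x) :
    capFun i (capFun (j + 2) σ) = capFun j (capFun i σ) := by
  funext x
  apply skip_injective j 2
  apply skip_injective i 2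
  have h1 := skip_ne i (skip j 2 x)
  have h2 := skip_ne (j + 2) (skip i 2 x)
  rw [skip_capFun j, join_capFun (q := j + 2) (q' := j + 2 + 1) (by simp [skip]; omega)
    (by simp [skip]; omega), skip_skip 2 2 hij, skip_capFun i, join_capFun (q := i)
    (q' := i + 1) (by simp [skip]; omega) (by simp [skip]; omega), ← skip_skip 2 2 hij]
  rw [← skip_skip 2 2 hij] at h2
  apply join_comm h <;> omega

/-! ### Inserting a planar matching -/

theorem insertAt_skip (j L : ℕ) (σ τ : ℕ → ℕ) (x : ℕ) :
    PlanarMatching.insertAt j L σ τ (skip j L x) = skip j L (σ x) := by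
  by_cases h : x < j
  · simp [PlanarMatching.insertAt, skip, h]
  · simp [PlanarMatching.insertAt, skip, h, show ¬ x + L < j by omega]

theorem insertAt_add {j L : ℕ} (σ τ : ℕ → ℕ) {x : ℕ} (hx : x < L) :
    PlanarMatching.insertAt j L σ τ (j + x) = j + τ x := by
  simp only [PlanarMatching.insertAt]
  rw [if_neg (by omega), if_pos (by omega), Nat.add_sub_cancel_left, Nat.add_comm]

theorem eq_add_or_eq_skip (j L x : ℕ) : (∃ y < L, x = j + y) ∨ ∃ y, x = skip j L y := by
  by_cases h : x < j
  · exact Or.inr ⟨x, by simp [skip, h]⟩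
  · by_cases h' : x < j + L
    · exact Or.inl ⟨x - j, by omega⟩
    · exact Or.inr ⟨x - L, by rw [skip, if_neg (by omega)]; omega⟩

theorem insertAt_involutive {j L : ℕ} {σ τ : ℕ → ℕ} (h : ∀ x, σ (σ x) = x)
    (hτ : IsPlanarMatching L τ) (x : ℕ) :
    PlanarMatching.insertAt j L σ τ (PlanarMatching.insertAt j L σ τ x) = x := by
  obtain ⟨y, hy, rfl⟩ | ⟨y, rfl⟩ := eq_add_or_eq_skip j L x
  · rw [insertAt_add _ _ hy, insertAt_add _ _ (hτ.2.1 y hy).1, hτ.2.2.1]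
  · rw [insertAt_skip, insertAt_skip, h]

theorem capFun_insertAt {i j L : ℕ} (hij : i ≤ j) (σ τ : ℕ → ℕ) :
    capFun i (PlanarMatching.insertAt (j + 2) L σ τ) =
      PlanarMatching.insertAt j L (capFun i σ) τ := by
  funext x
  apply skip_injective i 2
  rw [skip_capFun]
  obtain ⟨y, hy, rfl⟩ | ⟨y, rfl⟩ := eq_add_or_eq_skip j L x
  · have e (z : ℕ) : skip i 2 (j + z) = j + 2 + z := by
      rw [skip, if_neg (by omega)]; omega
    rw [insertAt_add _ _ hy, e, e, join, insertAt_add _ _ hy]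
    split_ifs <;> omega
  · rw [insertAt_skip, skip_skip 2 L hij, skip_skip 2 L hij, skip_capFun]
    exact join_semiconj (skip_injective _ _) (insertAt_skip _ _ _ _) (by simp [skip]; omega)
      (by simp [skip]; omega) _

theorem cupFun_insertAt {i j L : ℕ} (hij : i ≤ j) (σ τ : ℕ → ℕ) :
    cupFun i (PlanarMatching.insertAt j L σ τ) =
      PlanarMatching.insertAt (j + 2) L (cupFun i σ) τ := by
  funext x
  have e' : skip (j + 2) L i = i ∧ skip (j + 2) L (i + 1) = i + 1 := by
    unfold skip; split_ifs <;> omega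
  obtain rfl | rfl | ⟨y, rfl⟩ := eq_or_eq_skip i x
  · rw [cupFun_self]
    conv_rhs => rw [← e'.1, insertAt_skip, e'.1, cupFun_self, e'.2]
  · rw [cupFun_succ]
    conv_rhs => rw [← e'.2, insertAt_skip, cupFun_succ, e'.1]
  rw [cupFun_skip]
  obtain ⟨y, hy, rfl⟩ | ⟨y, rfl⟩ := eq_add_or_eq_skip j L y
  · have e (z : ℕ) : skip i 2 (j + z) = j + 2 + z := by
      rw [skip, if_neg (by omega)]; omega
    rw [insertAt_add _ _ hy, e, e, insertAt_add _ _ hy]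
  · rw [insertAt_skip, skip_skip 2 L hij, skip_skip 2 L hij, insertAt_skip, cupFun_skip]

/-! ### Counting closed components -/

/-- The number of closed components created by joining `i` and `i + 1`. -/
def loop (i : ℕ) (σ : ℕ → ℕ) : ℕ := if σ i = i + 1 then 1 else 0

theorem loop_cupFun_self (i : ℕ) (σ : ℕ → ℕ) : loop i (cupFun i σ) = 1 := by
  simp [loop, cupFun_self]

theorem loop_cupFun_succ (i : ℕ) (σ : ℕ → ℕ) : loop i (cupFun (i + 1) σ) = 0 := by
  have := skip_ne (i + 1) (σ i)
  simp [loop, cupFun, this]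

theorem loop_succ_cupFun (i : ℕ) (σ : ℕ → ℕ) : loop (i + 1) (cupFun i σ) = 0 := by
  rw [loop, cupFun_succ, if_neg (by omega)]

theorem loop_semiconj {i j : ℕ} {σ τ e : ℕ → ℕ} (he : Function.Injective e)
    (hτ : ∀ x, τ (e x) = e (σ x)) (hi : e i = j) (hi' : e (i + 1) = j + 1) :
    loop j τ = loop i σ := by
  rw [loop, loop, ← hi', ← hi, hτ]
  simp only [he.eq_iff]

theorem loop_cupFun_of_le {i j : ℕ} (hij : i ≤ j) (σ : ℕ → ℕ) :
    loop i (cupFun (j + 2) σ) = loop i σ :=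
  loop_semiconj (skip_injective _ _) (cupFun_skip _ _) (by simp [skip]; omega)
    (by simp [skip]; omega)

theorem loop_add_two_cupFun {i j : ℕ} (hij : i ≤ j) (σ : ℕ → ℕ) :
    loop (j + 2) (cupFun i σ) = loop j σ :=
  loop_semiconj (skip_injective _ _) (cupFun_skip _ _) (by simp [skip]; omega)
    (by simp [skip]; omega)

theorem loop_insertAt {i j L : ℕ} (hij : i ≤ j) (σ τ : ℕ → ℕ) :
    loop i (PlanarMatching.insertAt (j + 2) L σ τ) = loop i σ :=
  loop_semiconj (skip_injective _ _) (insertAt_skip _ _ _ _) (by simp [skip]; omega)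
    (by simp [skip]; omega)

/-- The order of two joinings may change which of them closes a component, but not how many
components are closed in total. -/
theorem loop_comm {p p' q q' : ℕ} {σ : ℕ → ℕ} (h : ∀ x, σ (σ x) = x) (h0 : p ≠ p') (h0' : q ≠ q')
    (h1 : p ≠ q) (h2 : p ≠ q') (h3 : p' ≠ q) (h4 : p' ≠ q') :
    (if σ q = q' then 1 else 0) + (if join q q' σ p = p' then 1 else 0) =
      (if σ p = p' then 1 else 0) + (if join p p' σ q = q' then 1 else 0) := by
  have := h p
  have := h p'
  have := h q
  have := h q'
  clear h
  unfold join
  grind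

theorem loop_capFun {i j : ℕ} (hij : i ≤ j) {σ : ℕ → ℕ} (h : ∀ x, σ (σ x) = x) :
    loop (j + 2) σ + loop i (capFun (j + 2) σ) = loop i σ + loop j (capFun i σ) := by
  have e : skip i 2 j = j + 2 ∧ skip i 2 (j + 1) = j + 2 + 1 := by
    unfold skip; split_ifs <;> omega
  have e' : skip (j + 2) 2 i = i ∧ skip (j + 2) 2 (i + 1) = i + 1 := by
    unfold skip; split_ifs <;> omega
  have k := skip_capFun i σ j
  have k' := skip_capFun (j + 2) σ i
  rw [e.1] at k
  rw [e'.1] at k'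
  have l := (skip_injective i 2).eq_iff (a := capFun i σ j) (b := j + 1)
  have l' := (skip_injective (j + 2) 2).eq_iff (a := capFun (j + 2) σ i) (b := i + 1)
  rw [k, e.2] at l
  rw [k', e'.2] at l'
  simp only [loop, ← l, ← l']
  apply loop_comm h <;> omega

end ArcDiagram

/-! ## Cup and cap operators -/

namespace ArcDiagram

/-- Join the points `i` and `i + 1`. -/
def cap (i : ℕ) (σ : ArcDiagram) : ArcDiagram := ⟨capFun i σ.1, capFun_involutive σ.2⟩

/-- Insert an arc just before the point `i`. -/
def cup (i : ℕ) (σ : ArcDiagram) : ArcDiagram := ⟨cupFun i σ.1, cupFun_involutive σ.2⟩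

/-- Insert a planar matching just before the point `j`. -/
def ins (j : ℕ) {L : ℕ} (e : PlanarMatching L) (σ : ArcDiagram) : ArcDiagram :=
  ⟨PlanarMatching.insertAt j L σ.1 e.1, insertAt_involutive σ.2 e.2⟩

end ArcDiagram

/-- Linear combinations of arc diagrams with loose ends. -/
abbrev ArcSpace (R : Type) [CommRing R] : Type := ArcDiagram →₀ R

namespace ArcSpace

open ArcDiagram

variable {R : Type} [CommRing R]

/-- The operator which joins the points `i` and `i + 1`; a closed component counts for `δ`. -/
def cap (δ : R) (i : ℕ) : Module.End R (ArcSpace R) :=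
  Finsupp.linearCombination R fun σ : ArcDiagram =>
    Finsupp.single (σ.cap i) (δ ^ loop i σ.1)

/-- The operator which inserts an arc just before the point `i`. -/
def cup (R : Type) [CommRing R] (i : ℕ) : Module.End R (ArcSpace R) :=
  Finsupp.linearCombination R fun σ : ArcDiagram =>
    Finsupp.single (σ.cup i) 1

/-- The operator which inserts a planar matching just before the point `j`. -/
def ins (R : Type) [CommRing R] (j : ℕ) {L : ℕ} (e : PlanarMatching L) :
    Module.End R (ArcSpace R) :=
  Finsupp.linearCombination R fun σ : ArcDiagram =>
    Finsupp.single (σ.ins j e) 1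

@[simp] theorem cap_single (δ : R) (i : ℕ) (σ : ArcDiagram) (c : R) :
    cap δ i (Finsupp.single σ c) =
      Finsupp.single (σ.cap i) (c * δ ^ loop i σ.1) := by
  simp [cap]

@[simp] theorem cup_single (i : ℕ) (σ : ArcDiagram) (c : R) :
    cup R i (Finsupp.single σ c) =
      Finsupp.single (σ.cup i) c := by
  simp [cup]

@[simp] theorem ins_single (j : ℕ) {L : ℕ} (e : PlanarMatching L) (σ : ArcDiagram) (c : R) :
    ins R j e (Finsupp.single σ c) = Finsupp.single
      (σ.ins j e) c := by
  simp [ins]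

theorem end_ext {S T : Module.End R (ArcSpace R)}
    (h : ∀ σ, S (Finsupp.single σ 1) = T (Finsupp.single σ 1)) : S = T :=
  Finsupp.lhom_ext' fun σ => LinearMap.ext_ring (by simpa using h σ)

theorem single_congr {σ τ : ArcDiagram} {c d : R} (h : σ.1 = τ.1) (h' : c = d) :
    (Finsupp.single σ c : ArcSpace R) = Finsupp.single τ d := by
  rw [Subtype.ext h, h']

theorem cap_mul_cup_self (δ : R) (i : ℕ) : cap δ i * cup R i = δ • 1 := by
  refine end_ext fun σ => ?_
  rw [Module.End.mul_apply, cup_single, cap_single, LinearMap.smul_apply, Module.End.one_apply,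
    Finsupp.smul_single]
  exact single_congr (capFun_cupFun_self i σ.1) (by simp [ArcDiagram.cup, loop_cupFun_self])

theorem cap_mul_cup_succ (δ : R) (i : ℕ) : cap δ i * cup R (i + 1) = 1 := by
  refine end_ext fun σ => ?_
  simp only [Module.End.mul_apply, cap_single, cup_single]
  exact single_congr (capFun_cupFun_succ σ.2) (by simp [ArcDiagram.cup, loop_cupFun_succ])

theorem cap_succ_mul_cup (δ : R) (i : ℕ) : cap δ (i + 1) * cup R i = 1 := by
  refine end_ext fun σ => ?_
  simp only [Module.End.mul_apply, cap_single, cup_single]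
  exact single_congr (capFun_succ_cupFun σ.2) (by simp [ArcDiagram.cup, loop_succ_cupFun])

theorem cap_mul_cup_of_le (δ : R) {i j : ℕ} (hij : i ≤ j) :
    cap δ i * cup R (j + 2) = cup R j * cap δ i := by
  refine end_ext fun σ => ?_
  simp only [Module.End.mul_apply, cap_single, cup_single]
  exact single_congr (capFun_cupFun_of_le hij _) (by simp [ArcDiagram.cup, loop_cupFun_of_le hij])

theorem cap_add_two_mul_cup (δ : R) {i j : ℕ} (hij : i ≤ j) :
    cap δ (j + 2) * cup R i = cup R i * cap δ j := by
  refine end_ext fun σ => ?_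
  simp only [Module.End.mul_apply, cap_single, cup_single]
  exact single_congr (capFun_add_two_cupFun hij _) (by simp [ArcDiagram.cup, loop_add_two_cupFun hij])

theorem cup_mul_cup {i j : ℕ} (hij : i ≤ j) : cup R i * cup R j = cup R (j + 2) * cup R i := by
  refine end_ext fun σ => ?_
  simp only [Module.End.mul_apply, cup_single]
  exact single_congr (cupFun_cupFun hij _) rfl

theorem cap_mul_cap (δ : R) {i j : ℕ} (hij : i ≤ j) :
    cap δ i * cap δ (j + 2) = cap δ j * cap δ i := by
  refine end_ext fun σ => ?_
  simp only [Module.End.mul_apply, cap_single, mul_assoc, ← pow_add]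
  exact single_congr (capFun_capFun hij σ.2) (by simp [ArcDiagram.cap, loop_capFun hij σ.2])

theorem cap_mul_ins (δ : R) {i j L : ℕ} (hij : i ≤ j) (e : PlanarMatching L) :
    cap δ i * ins R (j + 2) e = ins R j e * cap δ i := by
  refine end_ext fun σ => ?_
  simp only [Module.End.mul_apply, cap_single, ins_single]
  exact single_congr (capFun_insertAt hij _ _) (by simp [ArcDiagram.ins, loop_insertAt hij])

theorem cup_mul_ins {i j L : ℕ} (hij : i ≤ j) (e : PlanarMatching L) :
    cup R i * ins R j e = ins R (j + 2) e * cup R i := by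
  refine end_ext fun σ => ?_
  simp only [Module.End.mul_apply, cup_single, ins_single]
  exact single_congr (cupFun_insertAt hij _ _) rfl

/-- Join the points `k + n - 1 - j` and `k + n + j` for all `j < n`. -/
def caps (δ : R) (k : ℕ) : ℕ → Module.End R (ArcSpace R)
  | 0 => 1
  | n + 1 => caps δ k n * cap δ (k + n)

theorem cap_mul_caps (δ : R) {i k : ℕ} (h : i ≤ k) (n : ℕ) :
    cap δ i * caps δ (k + 2) n = caps δ k n * cap δ i := by
  induction n with
  | zero => simp [caps]
  | succ n ih =>
    rw [caps, caps, ← mul_assoc, ih, mul_assoc, mul_assoc, show k + 2 + n = k + n + 2 by omega,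
      cap_mul_cap δ (by omega)]

theorem cup_mul_caps (δ : R) {i k : ℕ} (h : i ≤ k) (n : ℕ) :
    cup R i * caps δ k n = caps δ (k + 2) n * cup R i := by
  induction n with
  | zero => simp [caps]
  | succ n ih =>
    rw [caps, caps, ← mul_assoc, ih, mul_assoc, mul_assoc, show k + 2 + n = k + n + 2 by omega,
      cap_add_two_mul_cup δ (by omega)]

/-- The two definitions differ only at loose ends, and neither `i` nor `i + 1` is loose in a planar
matching of `N + 2` points. -/
theorem capFun_eq_closeAt {N i : ℕ} {σ : ℕ → ℕ} (h : IsPlanarMatching (N + 2) σ) (hi : i ≤ N) :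
    capFun i σ = PlanarMatching.closeAt i σ := by
  funext x
  obtain ⟨-, h2, h3, -⟩ := h
  have a1 := (h2 i (by omega)).2
  have a2 := (h2 (i + 1) (by omega)).2
  have b1 := h3 i
  have b2 := h3 (i + 1)
  have hX := skip_ne i x
  have b3 := h3 (skip i 2 x)
  change _ = let y := σ (skip i 2 x)
    if y = i then (if σ (i + 1) < i then σ (i + 1) else σ (i + 1) - 2)
      else if y = i + 1 then (if σ i < i then σ i else σ i - 2) else if y < i then y else y - 2
  simp only [capFun, join]
  generalize skip i 2 x = X at *
  clear h2 h3
  grind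

end ArcSpace

/-- A planar matching as an arc diagram. -/
def PlanarMatching.toArc {N : ℕ} (d : PlanarMatching N) : ArcDiagram := ⟨d.1, d.2.2.2.1⟩

theorem PlanarMatching.toArc_injective (N : ℕ) :
    Function.Injective (PlanarMatching.toArc : PlanarMatching N → ArcDiagram) := fun _ _ h =>
  Subtype.ext (congrArg (fun σ : ArcDiagram => σ.1) h)

/-! ### Tangles inside the space of arc diagrams -/

namespace TLHom

open ArcSpace ArcDiagram

variable {R : Type} [CommRing R]

/-- A linear combination of tangles as a linear combination of arc diagrams. -/
def emb {m n : ℕ} : TLHom R m n →ₗ[R] ArcSpace R :=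
  Finsupp.lmapDomain R R PlanarMatching.toArc

@[simp] theorem emb_single {m n : ℕ} (d : PlanarMatching (n + m)) (c : R) :
    emb (Finsupp.single d c : TLHom R m n) = Finsupp.single d.toArc c := by
  simp [emb]

theorem emb_injective {m n : ℕ} : Function.Injective (emb : TLHom R m n → ArcSpace R) :=
  Finsupp.mapDomain_injective (PlanarMatching.toArc_injective _)

theorem emb_apply {m n : ℕ} (x : TLHom R m n) (d : PlanarMatching (n + m)) :
    emb x d.toArc = x d :=
  Finsupp.mapDomain_apply (PlanarMatching.toArc_injective _) x d

theorem emb_cast {m n m' n' : ℕ} (hm : m = m') (hn : n = n') (t : TLHom R m n) :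
    emb (cast hm hn t) = emb t := by
  subst hm hn
  rfl

theorem caps_single (δ : R) {k m : ℕ} : ∀ {n : ℕ} (σ : ArcDiagram) (c : R)
    (h : IsPlanarMatching (k + n + (n + m)) σ.1),
    ArcSpace.caps δ k n (Finsupp.single σ c) =
      Finsupp.single (PlanarMatching.toArc ⟨_, PlanarMatching.closeMany_isPlanar h⟩)
        (c * δ ^ PlanarMatching.loopsMany k n σ.1)
  | 0, σ, c, h => by
    rw [ArcSpace.caps, Module.End.one_apply]
    exact single_congr rfl (by simp [PlanarMatching.loopsMany])
  | n + 1, σ, c, h => by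
    have h' : IsPlanarMatching (k + n + (n + m) + 2) σ.1 := by
      rwa [show k + n + (n + m) + 2 = k + (n + 1) + (n + 1 + m) by omega]
    have e : (σ.cap (k + n)).1 = PlanarMatching.closeAt (k + n) σ.1 :=
      capFun_eq_closeAt h' (by omega)
    have ih := caps_single δ (n := n) (σ.cap (k + n)) (c * δ ^ loop (k + n) σ.1)
      (e ▸ PlanarMatching.closeAt_isPlanar h' (by omega))
    rw [ArcSpace.caps, Module.End.mul_apply, cap_single, ih]
    refine single_congr ?_ ?_
    · simp [PlanarMatching.toArc, PlanarMatching.closeMany, e]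
    · rw [e, PlanarMatching.loopsMany, pow_add, loop, mul_assoc]

/-- The word of the lower tangle is inserted right after the points of the upper one, and the facing
points are closed up. Each term is an operator applied to `emb v`, so cups and caps at the top of
`v` can be moved through it. -/
theorem emb_comp (δ : R) {m n k : ℕ} (v : TLHom R n k) (u : TLHom R m n) :
    emb (comp δ v u) =
      u.sum fun e b => b • ArcSpace.caps δ k n (ins R (k + n) e (emb v)) := by
  induction v using Finsupp.induction_linear with
  | zero => simp [comp]
  | add v v' h h' =>
    rw [comp, Finsupp.sum_add_index', map_add]
    · change emb (comp δ v u) + emb (comp δ v' u) = _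
      rw [h, h']
      simp [Finsupp.sum, Finset.sum_add_distrib]
    · simp
    · intro d a a'
      rw [← Finsupp.sum_add]
      simp [add_mul]
  | single d a =>
    rw [comp, Finsupp.sum_single_index (by simp), Finsupp.sum, map_sum, Finsupp.sum]
    refine Finset.sum_congr rfl fun e _ => ?_
    rw [emb_single, emb_single, ins_single,
      caps_single (m := m) δ (d.toArc.ins (k + n) e) _
        (PlanarMatching.insertAt_isPlanar d.2 e.2 le_rfl),
      Finsupp.smul_single, smul_eq_mul, ← mul_assoc, mul_comm (u e)]
    rfl

theorem emb_tensor {m n m' n' : ℕ} (v : TLHom R m n) (w : TLHom R m' n') :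
    emb (tensor v w) = w.sum fun e b => b • ins R n e (emb v) := by
  induction v using Finsupp.induction_linear with
  | zero => simp [tensor]
  | add v v' h h' =>
    rw [tensor, Finsupp.sum_add_index', map_add]
    · change emb (tensor v w) + emb (tensor v' w) = _
      rw [h, h']
      simp [Finsupp.sum, Finset.sum_add_distrib]
    · simp
    · intro d a a'
      rw [← Finsupp.sum_add]
      simp [add_mul]
  | single d a =>
    rw [tensor, Finsupp.sum_single_index (by simp), Finsupp.sum, map_sum, Finsupp.sum]
    refine Finset.sum_congr rfl fun e _ => ?_
    rw [emb_single, emb_single, ins_single, Finsupp.smul_single, smul_eq_mul, mul_comm (w e)]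
    rfl

end TLHom

/-! ## Words in cups and caps acting on tangles -/

namespace ArcSpace

open ArcDiagram

variable {R : Type} [CommRing R]

/-- The product `cup (i + n - 1) * ⋯ * cup (i + 1) * cup i`. -/
def cups (R : Type) [CommRing R] (i : ℕ) : ℕ → Module.End R (ArcSpace R)
  | 0 => 1
  | n + 1 => cup R (i + n) * cups R i n

theorem cap_mul_cups (δ : R) (i n : ℕ) :
    cap δ (i + n + n + 1) * cups R i (n + 1) = cups R (i + 1) n := by
  induction n with
  | zero => simp [cups, cap_succ_mul_cup]
  | succ n ih =>
    rw [cups, ← mul_assoc, show i + (n + 1) + (n + 1) + 1 = i + n + n + 1 + 2 by omega,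
      cap_add_two_mul_cup δ (by omega), mul_assoc, ih, cups, show i + (n + 1) = i + 1 + n by omega]

/-- The caps undo the cups one at a time by the snake relation. -/
theorem caps_mul_cups (δ : R) (n : ℕ) : ∀ i, caps δ (i + n) n * cups R i n = 1 := by
  induction n with
  | zero => simp [caps, cups]
  | succ n ih =>
    intro i
    rw [caps, mul_assoc, show i + (n + 1) + n = i + n + n + 1 by omega, cap_mul_cups,
      show i + (n + 1) = i + 1 + n by omega, ih]

theorem ins_mul_cups {L : ℕ} (e : PlanarMatching L) (n : ℕ) :
    ins R (n + n) e * cups R 0 n = cups R 0 n * ins R 0 e := by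
  induction n with
  | zero => simp [cups]
  | succ n ih =>
    rw [cups, ← mul_assoc, show n + 1 + (n + 1) = n + n + 2 by omega, Nat.zero_add,
      ← cup_mul_ins (by omega), mul_assoc, ih, mul_assoc]

/-- The arc diagram without arcs. -/
def _root_.ArcDiagram.empty : ArcDiagram := ⟨fun x => x, fun _ => rfl⟩

theorem cups_empty (n : ℕ) : cups R 0 n (Finsupp.single ArcDiagram.empty 1) =
    Finsupp.single (PlanarMatching.nested n).toArc 1 := by
  induction n with
  | zero =>
    refine single_congr ?_ rfl
    funext x
    simp [PlanarMatching.nested, PlanarMatching.toArc, ArcDiagram.empty]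
  | succ n ih =>
    rw [cups, Module.End.mul_apply, ih, cup_single]
    refine single_congr ?_ rfl
    funext x
    simp only [ArcDiagram.cup, PlanarMatching.nested, PlanarMatching.toArc, cupFun, skip]
    split_ifs <;> omega

end ArcSpace

namespace TLHom

open ArcSpace ArcDiagram

variable {R : Type} [CommRing R]

theorem emb_id (n : ℕ) : emb (id R n) = Finsupp.single (PlanarMatching.nested n).toArc 1 :=
  emb_single _ _

/-- The vertical strands are a word of cups applied to the empty diagram. Inserting `u` after them
commutes with these cups, and the closing caps then cancel the cups, leaving `u`. -/
theorem id_comp (δ : R) {m n : ℕ} (u : TLHom R m n) : comp δ (id R n) u = u := by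
  apply emb_injective
  rw [emb_comp, emb_id, ← cups_empty]
  simp only [← Module.End.mul_apply, ins_mul_cups]
  have := caps_mul_cups δ n 0
  rw [Nat.zero_add] at this
  simp only [← mul_assoc, this, one_mul, ins_single]
  conv_rhs => rw [← Finsupp.sum_single u, Finsupp.sum, map_sum]
  refine Finset.sum_congr rfl fun e _ => ?_
  change u e • Finsupp.single _ 1 = _
  rw [emb_single, Finsupp.smul_single]
  refine single_congr ?_ (mul_one _)
  funext x
  have := e.2.1 x
  simp only [ArcDiagram.ins, PlanarMatching.insertAt, ArcDiagram.empty, PlanarMatching.toArc]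
  split_ifs <;> first | omega | simp

theorem id_tensor_id (m n : ℕ) : tensor (id R m) (id R n) = id R (m + n) := by
  apply emb_injective
  rw [emb_tensor, emb_id, emb_id, id, Finsupp.sum_single_index (by simp), one_smul, ins_single]
  refine single_congr ?_ rfl
  funext x
  simp only [ArcDiagram.ins, PlanarMatching.insertAt, PlanarMatching.toArc, PlanarMatching.nested]
  split_ifs <;> omega

/-! ### Operators built from cups and caps -/

/-- The operators on arc diagrams which come from linear combinations of `(m, n)`-tangles. -/
inductive IsTangle (δ : R) : ℕ → ℕ → Module.End R (ArcSpace R) → Prop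
  | one (n : ℕ) : IsTangle δ n n 1
  | cap {n i : ℕ} (h : i ≤ n) : IsTangle δ (n + 2) n (ArcSpace.cap δ i)
  | cup {n i : ℕ} (h : i ≤ n) : IsTangle δ n (n + 2) (ArcSpace.cup R i)
  | mul {m n k : ℕ} {S T : Module.End R (ArcSpace R)} :
      IsTangle δ n k S → IsTangle δ m n T → IsTangle δ m k (S * T)
  | add {m n : ℕ} {S T : Module.End R (ArcSpace R)} :
      IsTangle δ m n S → IsTangle δ m n T → IsTangle δ m n (S + T)
  | smul {m n : ℕ} (c : R) {S : Module.End R (ArcSpace R)} :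
      IsTangle δ m n S → IsTangle δ m n (c • S)

theorem exists_emb_eq {m n n' : ℕ} {T : Module.End R (ArcSpace R)}
    (h : ∀ d : PlanarMatching (n + m), ∃ (d' : PlanarMatching (n' + m)) (c : R),
      T (Finsupp.single d.toArc 1) = Finsupp.single d'.toArc c) (v : TLHom R m n) :
    ∃ v' : TLHom R m n', emb v' = T (emb v) := by
  induction v using Finsupp.induction_linear with
  | zero => exact ⟨0, by simp⟩
  | add v w hv hw =>
    obtain ⟨v', hv⟩ := hv
    obtain ⟨w', hw⟩ := hw
    exact ⟨v' + w', by rw [map_add, map_add, map_add, hv, hw]⟩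
  | single d a =>
    obtain ⟨d', c, h⟩ := h d
    refine ⟨Finsupp.single d' (a * c), ?_⟩
    have e : (Finsupp.single d.toArc a : ArcSpace R) = a • Finsupp.single d.toArc 1 := by simp
    rw [emb_single, emb_single, e, map_smul, h, Finsupp.smul_single, smul_eq_mul]

/-- The cap sits to the left of all the points that gluing joins, so it commutes with the gluing up
to a shift of indices by two. -/
theorem emb_comp_of_cap (δ : R) {l m n i : ℕ} (hi : i ≤ n) {v : TLHom R m (n + 2)}
    {v' : TLHom R m n} (h : emb v' = ArcSpace.cap δ i (emb v)) (u : TLHom R l m) :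
    emb (comp δ v' u) = ArcSpace.cap δ i (emb (comp δ v u)) := by
  rw [emb_comp, emb_comp, h, Finsupp.sum, Finsupp.sum, map_sum]
  refine Finset.sum_congr rfl fun e _ => ?_
  have h' : ArcSpace.cap δ i * ins R (n + 2 + m) e = ins R (n + m) e * ArcSpace.cap δ i := by
    rw [show n + 2 + m = n + m + 2 by omega, cap_mul_ins δ (by omega)]
  simp only [map_smul, ← Module.End.mul_apply]
  rw [← mul_assoc (ArcSpace.cap δ i), cap_mul_caps δ hi, mul_assoc, h']

theorem emb_comp_of_cup (δ : R) {l m n i : ℕ} (hi : i ≤ n) {v : TLHom R m n}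
    {v' : TLHom R m (n + 2)} (h : emb v' = ArcSpace.cup R i (emb v)) (u : TLHom R l m) :
    emb (comp δ v' u) = ArcSpace.cup R i (emb (comp δ v u)) := by
  rw [emb_comp, emb_comp, h, Finsupp.sum, Finsupp.sum, map_sum]
  refine Finset.sum_congr rfl fun e _ => ?_
  have h' : ArcSpace.cup R i * ins R (n + m) e = ins R (n + 2 + m) e * ArcSpace.cup R i := by
    rw [show n + 2 + m = n + m + 2 by omega, cup_mul_ins (by omega)]
  simp only [map_smul, ← Module.End.mul_apply]
  rw [← mul_assoc (ArcSpace.cup R i), cup_mul_caps δ hi, mul_assoc, h']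

theorem exists_cap (δ : R) {m n i : ℕ} (hi : i ≤ n) (v : TLHom R m (n + 2)) :
    ∃ v' : TLHom R m n, emb v' = ArcSpace.cap δ i (emb v) := by
  refine exists_emb_eq (fun d => ?_) v
  have hd : IsPlanarMatching (n + m + 2) d.1 := by
    rw [show n + m + 2 = n + 2 + m by omega]
    exact d.2
  refine ⟨⟨_, PlanarMatching.closeAt_isPlanar (i := i) hd (by omega)⟩, 1 * δ ^ loop i d.1, ?_⟩
  rw [cap_single]
  exact single_congr (capFun_eq_closeAt hd (by omega)) rfl

theorem isPlanarMatching_cupFun {N i : ℕ} {σ : ℕ → ℕ} (h : IsPlanarMatching N σ) (hi : i ≤ N) :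
    IsPlanarMatching (N + 2) (cupFun i σ) := by
  have e : cupFun i σ = PlanarMatching.insertAt i (1 + 1) σ (PlanarMatching.nested 1).1 := by
    funext x
    simp only [cupFun, PlanarMatching.insertAt, PlanarMatching.nested, skip, Nat.reduceAdd]
    split_ifs <;> omega
  rw [e]
  exact PlanarMatching.insertAt_isPlanar h (PlanarMatching.nested 1).2 hi

theorem exists_cup {m n i : ℕ} (hi : i ≤ n) (v : TLHom R m n) :
    ∃ v' : TLHom R m (n + 2), emb v' = ArcSpace.cup R i (emb v) := by
  refine exists_emb_eq (fun d => ?_) v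
  refine ⟨⟨cupFun i d.1, ?_⟩, 1, ?_⟩
  · rw [show n + 2 + m = n + m + 2 by omega]
    exact isPlanarMatching_cupFun d.2 (by omega)
  · rw [cup_single]
    exact single_congr rfl rfl

/-- Such an operator touches only the top points of a tangle, whereas composition from below and
juxtaposition on the right happen beyond them. The three properties are proved for one common `v'`
so that they pass through products and sums. -/
theorem IsTangle.exists_apply {δ : R} {n n' : ℕ} {T : Module.End R (ArcSpace R)}
    (hT : IsTangle δ n n' T) {m : ℕ} (v : TLHom R m n) :
    ∃ v' : TLHom R m n', emb v' = T (emb v) ∧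
      (∀ (l : ℕ) (u : TLHom R l m), emb (comp δ v' u) = T (emb (comp δ v u))) ∧
      ∀ (m' k : ℕ) (w : TLHom R m' k), emb (tensor v' w) = T (emb (tensor v w)) := by
  induction hT with
  | one n => exact ⟨v, by simp⟩
  | @cap n i hi =>
    obtain ⟨v', h⟩ := exists_cap δ hi v
    refine ⟨v', h, fun l u => emb_comp_of_cap δ hi h u, fun m' k w => ?_⟩
    rw [emb_tensor, emb_tensor, h, Finsupp.sum, Finsupp.sum, map_sum]
    refine Finset.sum_congr rfl fun e _ => ?_
    simp only [map_smul, ← Module.End.mul_apply, cap_mul_ins δ hi]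
  | @cup n i hi =>
    obtain ⟨v', h⟩ := exists_cup hi v
    refine ⟨v', h, fun l u => emb_comp_of_cup δ hi h u, fun m' k w => ?_⟩
    rw [emb_tensor, emb_tensor, h, Finsupp.sum, Finsupp.sum, map_sum]
    refine Finset.sum_congr rfl fun e _ => ?_
    simp only [map_smul, ← Module.End.mul_apply, cup_mul_ins hi]
  | mul _ _ hS hT =>
    obtain ⟨v', h1, h2, h3⟩ := hT v
    obtain ⟨v'', k1, k2, k3⟩ := hS v'
    refine ⟨v'', ?_, fun l u => ?_, fun m' k w => ?_⟩
    · rw [k1, h1]; rfl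
    · rw [k2, h2]; rfl
    · rw [k3, h3]; rfl
  | add _ _ hS hT =>
    obtain ⟨v', h1, h2, h3⟩ := hT v
    obtain ⟨v'', k1, k2, k3⟩ := hS v
    refine ⟨v'' + v', ?_, fun l u => ?_, fun m' k w => ?_⟩
    · rw [map_add, k1, h1]; rfl
    · rw [LinearMap.add_apply, ← h2, ← k2]
      simp only [emb_comp, map_add, Finsupp.sum, smul_add, Finset.sum_add_distrib]
    · rw [LinearMap.add_apply, ← h3, ← k3]
      simp only [emb_tensor, map_add, Finsupp.sum, smul_add, Finset.sum_add_distrib]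
  | smul c _ hS =>
    obtain ⟨v'', k1, k2, k3⟩ := hS v
    refine ⟨c • v'', ?_, fun l u => ?_, fun m' k w => ?_⟩
    · rw [map_smul, k1]; rfl
    · rw [LinearMap.smul_apply, ← k2]
      simp only [emb_comp, map_smul, Finsupp.sum, Finset.smul_sum, smul_comm c]
    · rw [LinearMap.smul_apply, ← k3]
      simp only [emb_tensor, map_smul, Finsupp.sum, Finset.smul_sum, smul_comm c]

/-- The endomorphism `x` of `n` acts by composition as `T`. -/
theorem IsTangle.emb_comp {δ : R} {m n k : ℕ} {T : Module.End R (ArcSpace R)}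
    (hT : IsTangle δ n k T) {x : TLHom R n k} (hx : emb x = T (emb (id R n))) (y : TLHom R m n) :
    emb (comp δ x y) = T (emb y) := by
  obtain ⟨v, h1, h2, -⟩ := hT.exists_apply (id R n)
  obtain rfl : x = v := emb_injective (hx.trans h1.symm)
  rw [h2, id_comp]

theorem IsTangle.emb_tensor_id {δ : R} {n k : ℕ} {T : Module.End R (ArcSpace R)}
    (hT : IsTangle δ n k T) {x : TLHom R n k} (hx : emb x = T (emb (id R n))) (s : ℕ) :
    emb (tensor x (id R s)) = T (emb (id R (n + s))) := by
  obtain ⟨v, h1, -, h2⟩ := hT.exists_apply (id R n)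
  obtain rfl : x = v := emb_injective (hx.trans h1.symm)
  rw [h2, id_tensor_id]

/-- Points are numbered from the left, so the same operator serves for any number of extra strands
on the right. -/
theorem IsTangle.add_right {δ : R} {m n : ℕ} {T : Module.End R (ArcSpace R)}
    (hT : IsTangle δ m n T) (s : ℕ) : IsTangle δ (m + s) (n + s) T := by
  induction hT with
  | one n => exact .one _
  | @cap n i hi => rw [Nat.add_right_comm]; exact .cap (by omega)
  | @cup n i hi => rw [Nat.add_right_comm n]; exact .cup (by omega)
  | mul _ _ hS hT => exact .mul hS hT
  | add _ _ hS hT => exact .add hS hT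
  | smul c _ hS => exact .smul c hS

end TLHom

/-! ## Quantum integers -/

section QuantumIntegers

variable {K : Type} [Field K]

/-- No positive power of `A ^ 4` is `1`. -/
def IsGeneric (A : K) : Prop := A ≠ 0 ∧ ∀ k, 0 < k → A ^ (4 * k) ≠ 1

theorem sq_sub_inv_ne_zero {A : K} (hA : A ≠ 0) (h4 : A ^ 4 ≠ 1) : A ^ 2 - (A ^ 2)⁻¹ ≠ 0 := by
  intro h0
  apply h4
  field_simp at h0
  linear_combination h0

theorem qInt_eq {A : K} (hA : A ≠ 0) (h4 : A ^ 4 ≠ 1) (k : ℕ) :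
    qInt A k = A ^ 2 * (A ^ (4 * k) - 1) / (A ^ (2 * k) * (A ^ 4 - 1)) := by
  have h : A ^ 4 - 1 ≠ 0 := sub_ne_zero.2 h4
  have h' := sq_sub_inv_ne_zero hA h4
  rw [qInt, div_eq_div_iff h' (mul_ne_zero (pow_ne_zero _ hA) h),
    show 4 * k = 2 * k + 2 * k by ring, pow_add]
  field_simp

theorem qInt_zero (A : K) : qInt A 0 = 0 := by
  simp [qInt]

namespace IsGeneric

theorem pow_four_ne_one {A : K} (h : IsGeneric A) : A ^ 4 ≠ 1 := by
  simpa using h.2 1 one_pos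

theorem qInt_ne_zero {A : K} (h : IsGeneric A) {k : ℕ} (hk : 0 < k) : qInt A k ≠ 0 := by
  have h1 := h.1
  rw [qInt_eq h1 h.pow_four_ne_one]
  exact div_ne_zero (mul_ne_zero (pow_ne_zero _ h1) (sub_ne_zero.2 (h.2 k hk)))
    (mul_ne_zero (pow_ne_zero _ h1) (sub_ne_zero.2 h.pow_four_ne_one))

theorem qInt_one {A : K} (h : IsGeneric A) : qInt A 1 = 1 := by
  rw [qInt, mul_one, div_self (sq_sub_inv_ne_zero h.1 h.pow_four_ne_one)]

/-- Source of both the three-term recursion `qInt_add_two` and the factor [2r] in `jwBent_succ`. -/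
theorem qInt_mul_sub {A : K} (h : IsGeneric A) (a b : ℕ) :
    qInt A (a + 1) * qInt A (b + 1) - qInt A a * qInt A b = qInt A (a + b + 1) := by
  have h1 := h.1
  have h' := sq_sub_inv_ne_zero h.1 h.pow_four_ne_one
  simp only [qInt]
  rw [div_mul_div_comm, div_mul_div_comm, ← sub_div, div_eq_div_iff (mul_ne_zero h' h') h']
  simp only [mul_add, pow_add, mul_one]
  have ha := pow_ne_zero (2 * a) h1
  have hb := pow_ne_zero (2 * b) h1
  generalize A ^ (2 * a) = x at *
  generalize A ^ (2 * b) = y at *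
  field_simp
  ring

theorem qInt_add_two {A : K} (h : IsGeneric A) (k : ℕ) :
    qInt A (k + 2) = qInt A 2 * qInt A (k + 1) - qInt A k := by
  have := h.qInt_mul_sub k 1
  rw [h.qInt_one] at this
  linear_combination -this

end IsGeneric

end QuantumIntegers

/-! ## Jones–Wenzl idempotents as operators -/

namespace ArcSpace

variable {K : Type} [Field K]

/-- The operator of the Jones–Wenzl idempotent on the first `n` strands. -/
def jw (A : K) : ℕ → Module.End K (ArcSpace K)
  | 0 => 1
  | 1 => 1
  | k + 2 => jw A (k + 1) + (qInt A (k + 1) / qInt A (k + 2)) •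
      (jw A (k + 1) * (cup K k * cap (loopValue A) k * jw A (k + 1)))

/-- The operator `jw A k` is a polynomial in the cup-caps at positions `i` with `i + 2 ≤ k`. -/
theorem jw_commute (A : K) {x : Module.End K (ArcSpace K)} : ∀ {k : ℕ},
    (∀ i, i + 2 ≤ k → Commute (cup K i * cap (loopValue A) i) x) → Commute (jw A k) x
  | 0, _ => Commute.one_left x
  | 1, _ => Commute.one_left x
  | k + 2, h => by
    have ih := jw_commute A (x := x) (k := k + 1) fun i hi => h i (by omega)
    rw [jw]
    exact ih.add_left ((ih.mul_left ((h k le_rfl).mul_left ih)).smul_left _)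

theorem jw_commute_cup (A : K) {k n : ℕ} (h : k ≤ n) : Commute (jw A k) (cup K n) := by
  refine jw_commute A fun i hi => ?_
  obtain ⟨n, rfl⟩ : ∃ j, n = j + 2 := ⟨n - 2, by omega⟩
  rw [commute_iff_eq, mul_assoc, cap_mul_cup_of_le _ (by omega), ← mul_assoc,
    cup_mul_cup (by omega), mul_assoc]

theorem jw_commute_cap (A : K) {k n : ℕ} (h : k ≤ n) :
    Commute (jw A k) (cap (loopValue A) n) := by
  refine jw_commute A fun i hi => ?_
  obtain ⟨n, rfl⟩ : ∃ j, n = j + 2 := ⟨n - 2, by omega⟩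
  rw [commute_iff_eq, mul_assoc, cap_mul_cap _ (by omega), ← mul_assoc, ← mul_assoc,
    cap_add_two_mul_cup _ (by omega)]

/-- Idempotence and the partial trace depend on each other; the lemmas ending in `_of_idem` assume
idempotence one level down, and `jw_idem_aux` closes the induction. -/
theorem jw_succ_mul_of_idem {A : K} : ∀ {k : ℕ}, jw A k * jw A k = jw A k →
    jw A (k + 1) * jw A k = jw A (k + 1)
  | 0, _ => by simp [jw]
  | k + 1, h => by
    rw [jw, add_mul, smul_mul_assoc, mul_assoc, mul_assoc, h]

theorem mul_jw_succ_of_idem {A : K} : ∀ {k : ℕ}, jw A k * jw A k = jw A k →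
    jw A k * jw A (k + 1) = jw A (k + 1)
  | 0, _ => by simp [jw]
  | k + 1, h => by
    rw [jw, mul_add, mul_smul_comm, ← mul_assoc (jw A (k + 1)), h]

/-- The partial trace. In the recursion for `jw`, the first summand yields a closed loop and the
second two zigzags, so the factor is -[2] + [k+1]/[k+2] = -[k+3]/[k+2]. -/
theorem cap_jw_cup_of_idem {A : K} (hA : IsGeneric A) : ∀ {k : ℕ}, jw A k * jw A k = jw A k →
    cap (loopValue A) k * jw A (k + 1) * cup K k = -(qInt A (k + 2) / qInt A (k + 1)) • jw A k
  | 0, _ => by simp [jw, cap_mul_cup_self, loopValue, hA.qInt_one]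
  | k + 1, h => by
    have h1 := (jw_commute_cup A (le_refl (k + 1))).eq
    have h2 := (jw_commute_cap A (le_refl (k + 1))).eq
    have h0 := hA.qInt_ne_zero (k := k + 2) (by omega)
    have e1 : cap (loopValue A) (k + 1) * jw A (k + 1) * cup K (k + 1) =
        loopValue A • jw A (k + 1) := by
      rw [mul_assoc, h1, ← mul_assoc, cap_mul_cup_self, smul_mul_assoc, one_mul]
    have e2 : cap (loopValue A) (k + 1) * (jw A (k + 1) * (cup K k * cap (loopValue A) k *
        jw A (k + 1))) * cup K (k + 1) = jw A (k + 1) := by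
      calc _ = cap (loopValue A) (k + 1) * jw A (k + 1) * (cup K k * cap (loopValue A) k *
            (jw A (k + 1) * cup K (k + 1))) := by simp only [mul_assoc]
        _ = jw A (k + 1) * ((cap (loopValue A) (k + 1) * cup K k) *
            (cap (loopValue A) k * cup K (k + 1))) * jw A (k + 1) := by
          rw [h1, ← h2]; simp only [mul_assoc]
        _ = _ := by rw [cap_succ_mul_cup, cap_mul_cup_succ, mul_one, mul_one, h]
    rw [jw, mul_add, add_mul, mul_smul_comm, smul_mul_assoc, e1, e2, ← add_smul]
    congr 1
    rw [loopValue, hA.qInt_add_two (k + 1)]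
    field_simp
    ring

theorem cup_cap_jw_of_idem {A : K} (hA : IsGeneric A) {k : ℕ} (h : jw A k * jw A k = jw A k) :
    jw A (k + 1) * (cup K k * cap (loopValue A) k * jw A (k + 1)) *
      (cup K k * cap (loopValue A) k * jw A (k + 1)) = -(qInt A (k + 2) / qInt A (k + 1)) •
        (jw A (k + 1) * (cup K k * cap (loopValue A) k * jw A (k + 1))) := by
  have e := cap_jw_cup_of_idem hA h
  calc _ = jw A (k + 1) * (cup K k * (cap (loopValue A) k * jw A (k + 1) * cup K k) *
        cap (loopValue A) k * jw A (k + 1)) := by simp only [mul_assoc]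
    _ = -(qInt A (k + 2) / qInt A (k + 1)) • (jw A (k + 1) * (cup K k * jw A k *
        cap (loopValue A) k * jw A (k + 1))) := by
      rw [e]; simp only [mul_smul_comm, smul_mul_assoc]
    _ = _ := by
      rw [← (jw_commute_cup A (le_refl k)).eq, ← mul_assoc, ← mul_assoc, ← mul_assoc,
        jw_succ_mul_of_idem h]
      simp only [mul_assoc]

/-- With c = [k+1]/[k+2], the partial trace gives gUU = -(1/c) gU, so (g + c gU)² = g + (2c - c) gU.
-/
theorem jw_idem_aux {A : K} (hA : IsGeneric A) : ∀ k, jw A k * jw A k = jw A k ∧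
    jw A (k + 1) * jw A (k + 1) = jw A (k + 1)
  | 0 => by simp [jw]
  | k + 1 => by
    obtain ⟨h, h'⟩ := jw_idem_aux hA k
    refine ⟨h', ?_⟩
    have e := cup_cap_jw_of_idem hA h
    have h1 := hA.qInt_ne_zero (k := k + 1) (by omega)
    have h2 := hA.qInt_ne_zero (k := k + 2) (by omega)
    rw [jw]
    set g := jw A (k + 1)
    set U := cup K k * cap (loopValue A) k * g
    have e1 : g * U * g = g * U := by simp only [U, mul_assoc, h']
    have e2 : g * U * (g * U) = g * U * U := by rw [← mul_assoc, e1]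
    have e3 : g * (g * U) = g * U := by rw [← mul_assoc, h']
    rw [mul_add, add_mul, add_mul, mul_smul_comm, smul_mul_assoc, smul_mul_smul_comm, e2, e, e1,
      e3, h', smul_smul, add_assoc, ← add_smul, ← add_smul]
    congr 2
    field_simp
    ring

theorem jw_idem {A : K} (hA : IsGeneric A) (k : ℕ) : jw A k * jw A k = jw A k :=
  (jw_idem_aux hA k).1

theorem cap_jw_cup {A : K} (hA : IsGeneric A) (k : ℕ) :
    cap (loopValue A) k * jw A (k + 1) * cup K k = -(qInt A (k + 2) / qInt A (k + 1)) • jw A k :=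
  cap_jw_cup_of_idem hA (jw_idem hA k)

theorem jw_mul_jw {A : K} (hA : IsGeneric A) {j k : ℕ} (h : j ≤ k) :
    jw A k * jw A j = jw A k := by
  induction k, h using Nat.le_induction with
  | base => exact jw_idem hA j
  | succ k _ ih => rw [← jw_succ_mul_of_idem (jw_idem hA k), mul_assoc, ih]

theorem jw_mul_jw' {A : K} (hA : IsGeneric A) {j k : ℕ} (h : j ≤ k) :
    jw A j * jw A k = jw A k := by
  induction k, h using Nat.le_induction with
  | base => exact jw_idem hA j
  | succ k _ ih => rw [← mul_jw_succ_of_idem (jw_idem hA k), ← mul_assoc, ih]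

/-- For `k = i + 2` the partial trace makes the two summands of the recursion cancel; larger `k`
follow by absorption of `jw A (i + 2)`. -/
theorem jw_mul_cup {A : K} (hA : IsGeneric A) {i k : ℕ} (h : i + 2 ≤ k) :
    jw A k * cup K i = 0 := by
  have key : jw A (i + 2) * cup K i = 0 := by
    have h1 := hA.qInt_ne_zero (k := i + 1) (by omega)
    have h2 := hA.qInt_ne_zero (k := i + 2) (by omega)
    have e := cap_jw_cup hA i
    rw [jw, add_mul, smul_mul_assoc]
    have e' : jw A (i + 1) * (cup K i * cap (loopValue A) i * jw A (i + 1)) * cup K i =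
        jw A (i + 1) * (cup K i * (cap (loopValue A) i * jw A (i + 1) * cup K i)) := by
      simp only [mul_assoc]
    rw [e', e, mul_smul_comm, mul_smul_comm, ← (jw_commute_cup A (le_refl i)).eq, ← mul_assoc,
      jw_mul_jw hA (by omega), smul_smul]
    rw [show qInt A (i + 1) / qInt A (i + 2) * -(qInt A (i + 2) / qInt A (i + 1)) = -1 by
      field_simp]
    nth_rw 1 [← one_smul K (jw A (i + 1) * cup K i)]
    rw [← add_smul, add_neg_cancel, zero_smul]
  rw [← jw_mul_jw hA h, mul_assoc, key, mul_zero]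

theorem cap_mul_jw {A : K} (hA : IsGeneric A) {i k : ℕ} (h : i + 2 ≤ k) :
    cap (loopValue A) i * jw A k = 0 := by
  have key : cap (loopValue A) i * jw A (i + 2) = 0 := by
    have h1 := hA.qInt_ne_zero (k := i + 1) (by omega)
    have h2 := hA.qInt_ne_zero (k := i + 2) (by omega)
    have e := cap_jw_cup hA i
    rw [jw, mul_add, mul_smul_comm]
    have e' : cap (loopValue A) i * (jw A (i + 1) *
        (cup K i * cap (loopValue A) i * jw A (i + 1))) =
        cap (loopValue A) i * jw A (i + 1) * cup K i * cap (loopValue A) i * jw A (i + 1) := by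
      simp only [mul_assoc]
    rw [e', e, smul_mul_assoc, smul_mul_assoc, (jw_commute_cap A (le_refl i)).eq, mul_assoc,
      jw_mul_jw' hA (by omega), smul_smul]
    rw [show qInt A (i + 1) / qInt A (i + 2) * -(qInt A (i + 2) / qInt A (i + 1)) = -1 by
      field_simp]
    nth_rw 1 [← one_smul K (cap (loopValue A) i * jw A (i + 1))]
    rw [← add_smul, add_neg_cancel, zero_smul]
  rw [← jw_mul_jw' hA h, ← mul_assoc, key, zero_mul]

end ArcSpace

/-! ## Partially closed Jones–Wenzl idempotents -/

namespace ArcSpace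

variable {K : Type} [Field K]

/-- The idempotent on `R` strands composed with `s` nested cups at its right end. -/
def bentCup (A : K) (R : ℕ) : ℕ → Module.End K (ArcSpace K)
  | 0 => jw A R
  | s + 1 => bentCup A R s * cup K (R - 1 - s)

/-- The idempotent on `R` strands composed with `s` nested caps at its right end. -/
def bentCap (A : K) (R : ℕ) : ℕ → Module.End K (ArcSpace K)
  | 0 => jw A R
  | s + 1 => cap (loopValue A) (R - 1 - s) * bentCap A R s

/-- The idempotent on `R + s` strands which factors through the idempotent on `R - s` strands. -/
def bent (A : K) (R s : ℕ) : Module.End K (ArcSpace K) :=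
  ((-1) ^ s * qInt A (R + 1 - s) / qInt A (R + 1)) • (bentCup A R s * bentCap A R s)

/-- The operator of the idempotent `f_n + [r]⁻¹ h_n`, for `n = R + s` and `r = R + 1`. -/
def jwBent (A : K) (R s : ℕ) : Module.End K (ArcSpace K) := jw A (R + s) + bent A R s

variable {A : K}

theorem bentCup_mul_jw (hA : IsGeneric A) {R : ℕ} : ∀ {s : ℕ}, s ≤ R →
    bentCup A R s * jw A (R - s) = bentCup A R s
  | 0, _ => jw_idem hA R
  | s + 1, h => by
    rw [bentCup, mul_assoc, show R - (s + 1) = R - 1 - s by omega,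
      ← (jw_commute_cup A le_rfl).eq, ← mul_assoc, ← bentCup_mul_jw hA (s := s) (by omega),
      mul_assoc (bentCup A R s), jw_mul_jw hA (by omega)]

theorem jw_mul_bentCap (hA : IsGeneric A) {R : ℕ} : ∀ {s : ℕ}, s ≤ R →
    jw A (R - s) * bentCap A R s = bentCap A R s
  | 0, _ => jw_idem hA R
  | s + 1, h => by
    rw [bentCap, ← mul_assoc, show R - (s + 1) = R - 1 - s by omega,
      (jw_commute_cap A le_rfl).eq, mul_assoc, ← jw_mul_bentCap hA (s := s) (by omega),
      ← mul_assoc (jw A (R - 1 - s)), jw_mul_jw' hA (by omega)]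

/-- An iterated partial trace whose factors telescope. It explains the normalization of `bent`,
which this makes idempotent. -/
theorem bentCap_mul_bentCup (hA : IsGeneric A) {R : ℕ} : ∀ {s : ℕ}, s ≤ R →
    bentCap A R s * bentCup A R s =
      ((-1) ^ s * qInt A (R + 1) / qInt A (R + 1 - s)) • jw A (R - s)
  | 0, _ => by
    have := hA.qInt_ne_zero (k := R + 1) (by omega)
    simp [bentCap, bentCup, jw_idem hA, this]
  | s + 1, h => by
    obtain ⟨k, rfl⟩ : ∃ k, R = k + 1 + s := ⟨R - 1 - s, by omega⟩
    have h1 := hA.qInt_ne_zero (k := k + 2) (by omega)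
    have h2 := hA.qInt_ne_zero (k := k + 1) (by omega)
    have ih := bentCap_mul_bentCup hA (R := k + 1 + s) (s := s) (by omega)
    rw [show k + 1 + s - s = k + 1 by omega, show k + 1 + s + 1 - s = k + 2 by omega] at ih
    rw [bentCap, bentCup, show k + 1 + s - 1 - s = k by omega,
      show k + 1 + s - (s + 1) = k by omega, show k + 1 + s + 1 - (s + 1) = k + 1 by omega]
    calc _ = cap (loopValue A) k * (bentCap A (k + 1 + s) s * bentCup A (k + 1 + s) s) *
          cup K k := by simp only [mul_assoc]
      _ = _ := by
        rw [ih, mul_smul_comm, smul_mul_assoc, cap_jw_cup hA, smul_smul]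
        congr 1
        rw [pow_succ]
        field_simp

theorem cap_mul_bentCup_of_le (A : K) {R : ℕ} : ∀ {s : ℕ} (t : ℕ), s ≤ R →
    cap (loopValue A) (R + s + t) * bentCup A R s = bentCup A R s * cap (loopValue A) (R - s + t)
  | 0, t, _ => (jw_commute_cap A (by omega)).eq.symm
  | s + 1, t, h => by
    rw [bentCup, ← mul_assoc, show R + (s + 1) + t = R + s + (t + 1) by omega,
      cap_mul_bentCup_of_le A (t + 1) (by omega), mul_assoc, mul_assoc,
      show R - s + (t + 1) = R - (s + 1) + t + 2 by omega, cap_add_two_mul_cup _ (by omega)]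

theorem bentCap_mul_cup_of_le (A : K) {R : ℕ} : ∀ {s : ℕ} (t : ℕ), s ≤ R →
    bentCap A R s * cup K (R + s + t) = cup K (R - s + t) * bentCap A R s
  | 0, t, _ => (jw_commute_cup A (by omega)).eq
  | s + 1, t, h => by
    rw [bentCap, mul_assoc, show R + (s + 1) + t = R + s + (t + 1) by omega,
      bentCap_mul_cup_of_le A (t + 1) (by omega), ← mul_assoc, ← mul_assoc,
      show R - s + (t + 1) = R - (s + 1) + t + 2 by omega, cap_mul_cup_of_le _ (by omega)]

/-- After moving past the outer cups, the cap forms a zigzag with the last cup and removes it. -/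
theorem cap_mul_bentCup_succ (A : K) {R s : ℕ} (h : s + 1 ≤ R) :
    cap (loopValue A) (R + s) * bentCup A R (s + 1) = bentCup A R s := by
  rw [bentCup, ← mul_assoc, ← Nat.add_zero (R + s), cap_mul_bentCup_of_le A 0 (by omega),
    mul_assoc, Nat.add_zero, show R - s = R - 1 - s + 1 by omega, cap_succ_mul_cup, mul_one]

theorem bentCap_succ_mul_cup (A : K) {R s : ℕ} (h : s + 1 ≤ R) :
    bentCap A R (s + 1) * cup K (R + s) = bentCap A R s := by
  rw [bentCap, mul_assoc, ← Nat.add_zero (R + s), bentCap_mul_cup_of_le A 0 (by omega),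
    ← mul_assoc, Nat.add_zero, show R - s = R - 1 - s + 1 by omega, cap_mul_cup_succ, one_mul]

/-- The far cup can be moved aside; then `jw A n` absorbs `jw A R` and meets the cup at `R - 1`,
which it kills. -/
theorem jw_mul_cup_mul_bentCup (hA : IsGeneric A) {R m n : ℕ} (hm : R + 1 ≤ m) (hn : R + 1 ≤ n) :
    ∀ {t : ℕ}, t + 1 ≤ R → jw A n * cup K m * bentCup A R (t + 1) = 0
  | 0, h => by
    obtain ⟨m, rfl⟩ : ∃ j, m = j + 2 := ⟨m - 2, by omega⟩
    rw [bentCup, bentCup, mul_assoc, ← mul_assoc (cup K (m + 2)),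
      ← (jw_commute_cup A (by omega)).eq, mul_assoc, ← mul_assoc, jw_mul_jw hA (by omega),
      ← cup_mul_cup (by omega), ← mul_assoc, jw_mul_cup hA (by omega), zero_mul]
  | t + 1, h => by
    rw [bentCup, ← mul_assoc, jw_mul_cup_mul_bentCup hA hm hn (by omega), zero_mul]

theorem bentCap_mul_cap_mul_jw (hA : IsGeneric A) {R m n : ℕ} (hm : R + 1 ≤ m) (hn : R + 1 ≤ n) :
    ∀ {t : ℕ}, t + 1 ≤ R → bentCap A R (t + 1) * (cap (loopValue A) m * jw A n) = 0
  | 0, h => by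
    obtain ⟨m, rfl⟩ : ∃ j, m = j + 2 := ⟨m - 2, by omega⟩
    rw [bentCap, bentCap, mul_assoc, ← mul_assoc (jw A R),
      (jw_commute_cap A (by omega)).eq, mul_assoc, jw_mul_jw' hA (by omega), ← mul_assoc,
      cap_mul_cap _ (by omega), mul_assoc, cap_mul_jw hA (by omega), mul_zero]
  | t + 1, h => by
    rw [bentCap, mul_assoc, bentCap_mul_cap_mul_jw hA hm hn (by omega), mul_zero]

/-- The Jones–Wenzl recursion for the inner idempotent in disguise. Sandwiching the cup-cap leaves
`jw A (R - t)` between the cups and the caps; expanding it gives one term with `t + 1` cups, which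
cancels against `bent A R (t + 1)` (`c1`), and one with `t + 2` (`c2`). -/
theorem bent_succ (hA : IsGeneric A) {R t : ℕ} (h : t + 1 ≤ R) :
    bent A R (t + 2) = bent A R (t + 1) + (qInt A (R + 1 - t) / qInt A (R - t)) •
      (bent A R (t + 1) * (cup K (R + t) * cap (loopValue A) (R + t) * bent A R (t + 1))) := by
  obtain ⟨k, rfl⟩ : ∃ k, R = k + t + 1 := ⟨R - 1 - t, by omega⟩
  have h0 := hA.qInt_ne_zero (k := k + t + 2) (by omega)
  have h1 := hA.qInt_ne_zero (k := k + 2) (by omega)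
  have h2 := hA.qInt_ne_zero (k := k + 1) (by omega)
  have e : bentCup A (k + t + 1) (t + 1) * bentCap A (k + t + 1) (t + 1) *
      (cup K (k + t + 1 + t) * cap (loopValue A) (k + t + 1 + t) *
        (bentCup A (k + t + 1) (t + 1) * bentCap A (k + t + 1) (t + 1))) =
      ((-1) ^ t * qInt A (k + t + 2) / qInt A (k + 2)) •
        (bentCup A (k + t + 1) (t + 1) * jw A (k + 1) * bentCap A (k + t + 1) (t + 1)) := by
    calc _ = bentCup A (k + t + 1) (t + 1) *
          ((bentCap A (k + t + 1) (t + 1) * cup K (k + t + 1 + t)) *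
          (cap (loopValue A) (k + t + 1 + t) * bentCup A (k + t + 1) (t + 1))) *
          bentCap A (k + t + 1) (t + 1) := by simp only [mul_assoc]
      _ = _ := by
        rw [cap_mul_bentCup_succ A h, bentCap_succ_mul_cup A h,
          bentCap_mul_bentCup hA (by omega), mul_smul_comm, smul_mul_assoc,
          show k + t + 1 - t = k + 1 by omega, show k + t + 1 + 1 - t = k + 2 by omega]
  have e' : bentCup A (k + t + 1) (t + 1) * jw A (k + 1) * bentCap A (k + t + 1) (t + 1) =
      bentCup A (k + t + 1) (t + 1) * bentCap A (k + t + 1) (t + 1) +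
      (qInt A k / qInt A (k + 1)) •
        (bentCup A (k + t + 1) (t + 2) * bentCap A (k + t + 1) (t + 2)) := by
    have b := bentCup_mul_jw hA h
    have c := jw_mul_bentCap hA h
    rw [show k + t + 1 - (t + 1) = k by omega] at b c
    cases k with
    -- No strand is left to bend, and the index of the next cup is truncated to 0; the factor [0]
    -- removes that term.
    | zero => simp [jw, qInt_zero]
    | succ k =>
      have i : k + 1 + t + 1 - 1 - (t + 1) = k := by omega
      have d : bentCup A (k + 1 + t + 1) (t + 2) = bentCup A (k + 1 + t + 1) (t + 1) * cup K k := by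
        rw [bentCup, i]
      have d' : bentCap A (k + 1 + t + 1) (t + 2) =
          cap (loopValue A) k * bentCap A (k + 1 + t + 1) (t + 1) := by
        rw [bentCap, i]
      rw [d, d', jw, mul_add, add_mul, b, mul_smul_comm, smul_mul_assoc]
      congr 2
      calc _ = bentCup A (k + 1 + t + 1) (t + 1) * jw A (k + 1) * (cup K k *
            cap (loopValue A) k) * (jw A (k + 1) * bentCap A (k + 1 + t + 1) (t + 1)) := by
            simp only [mul_assoc]
        _ = _ := by rw [b, c]; simp only [mul_assoc]
  simp only [bent, smul_mul_assoc, mul_smul_comm]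
  rw [e, e', show k + t + 1 + 1 - (t + 2) = k by omega, show k + t + 1 - t = k + 1 by omega,
    show k + t + 1 + 1 - (t + 1) = k + 1 by omega, show k + t + 1 + 1 - t = k + 2 by omega]
  simp only [smul_add, smul_smul, ← add_assoc]
  rw [← add_smul]
  have c1 : (-1 : K) ^ (t + 1) * qInt A (k + 1) / qInt A (k + t + 1 + 1) +
      qInt A (k + 2) / qInt A (k + 1) * ((-1) ^ (t + 1) * qInt A (k + 1) / qInt A (k + t + 1 + 1) *
        ((-1) ^ (t + 1) * qInt A (k + 1) / qInt A (k + t + 1 + 1) *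
          ((-1) ^ t * qInt A (k + t + 2) / qInt A (k + 2)))) = 0 := by
    rw [show k + t + 1 + 1 = k + t + 2 by omega, pow_succ]
    rcases neg_one_pow_eq_or K t with s | s <;> rw [s] <;> field_simp <;> ring
  have c2 : qInt A (k + 2) / qInt A (k + 1) *
      ((-1) ^ (t + 1) * qInt A (k + 1) / qInt A (k + t + 1 + 1) *
        ((-1) ^ (t + 1) * qInt A (k + 1) / qInt A (k + t + 1 + 1) *
          ((-1) ^ t * qInt A (k + t + 2) / qInt A (k + 2) * (qInt A k / qInt A (k + 1))))) =
      (-1) ^ (t + 2) * qInt A k / qInt A (k + t + 1 + 1) := by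
    rw [show k + t + 1 + 1 = k + t + 2 by omega, pow_succ, pow_add]
    rcases neg_one_pow_eq_or K t with s | s <;> rw [s] <;> field_simp
  rw [c1, c2, zero_smul, zero_add]

/-- Here `bent A R 1` is exactly the negative of the correction term in the recursion for `jw`. -/
theorem jwBent_one (A : K) {R : ℕ} (hR : 1 ≤ R) : jwBent A R 1 = jw A R := by
  obtain ⟨k, rfl⟩ : ∃ k, R = k + 1 := ⟨R - 1, by omega⟩
  rw [jwBent, bent, bentCup, bentCap, bentCup, bentCap, show k + 1 + 1 - 1 = k + 1 by omega,
    show k + 1 - 1 - 0 = k by omega, jw, add_assoc, mul_assoc, mul_assoc, ← add_smul]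
  simp [neg_div]

/-- At this step the mixed products of `jw` and `bent` do not vanish as they do in `jwBent_succ`, so
everything is expanded. The pole at [R+1] = 0 disappears by [R] + [R+2] = [2][R+1]. -/
theorem jwBent_two (hA : IsGeneric A) {R : ℕ} (hR : 1 ≤ R) :
    jwBent A R 2 = jw A R + (qInt A (R + 1) / qInt A (R + 2)) •
        (jw A R * (cup K R * cap (loopValue A) R * jw A R)) +
      (qInt A R / qInt A (R + 2)) • (bentCup A R 1 * bentCap A R 1 *
          (cup K R * cap (loopValue A) R * jw A R) +
        jw A R * (cup K R * cap (loopValue A) R * (bentCup A R 1 * bentCap A R 1))) +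
      (qInt A 2 * qInt A R / qInt A (R + 2)) • (bentCup A R 1 * bentCap A R 1 *
        (cup K R * cap (loopValue A) R * (bentCup A R 1 * bentCap A R 1))) := by
  have h0 := hA.qInt_ne_zero (k := R + 2) (by omega)
  have h1 := hA.qInt_ne_zero (k := R + 1) (by omega)
  have h2 := hA.qInt_ne_zero (k := R) (by omega)
  have h3 := hA.qInt_add_two R
  have e1 : jw A (R + 1) = jw A R + (qInt A R / qInt A (R + 1)) •
      (bentCup A R 1 * bentCap A R 1) := by
    obtain ⟨k, rfl⟩ : ∃ k, R = k + 1 := ⟨R - 1, by omega⟩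
    rw [jw, bentCup, bentCap, bentCup, bentCap, show k + 1 - 1 - 0 = k by omega]
    simp only [mul_assoc]
  rw [jwBent, bent_succ hA (t := 0) (by omega), bent, jw, e1]
  simp only [Nat.add_zero, Nat.zero_add, Nat.sub_zero, Nat.add_sub_cancel]
  generalize bentCup A R 1 * bentCap A R 1 = H at *
  generalize cup K R * cap (loopValue A) R = U at *
  generalize jw A R = F at *
  simp only [add_mul, mul_add, smul_mul_assoc, mul_smul_comm, smul_add, smul_smul]
  match_scalars
  · simp
  · field_simp
    ring
  · field_simp
  · field_simp
  · field_simp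
  · field_simp
    linear_combination h3

/-- The mixed terms `e1` and `e2` vanish, so the recursions of `jw` and `bent` run side by side.
Their coefficients [R+t+2]/[R+t+3] and [R-t]/[R-t-1] differ, and by `qInt_mul_sub` the discrepancy
is a multiple of [2R+2]. -/
theorem jwBent_succ (hA : IsGeneric A) {R t : ℕ} (h : t + 2 ≤ R) :
    jwBent A R (t + 3) = jwBent A R (t + 2) +
      (qInt A (R + t + 2) / qInt A (R + t + 3)) • (jwBent A R (t + 2) *
        (cup K (R + t + 1) * cap (loopValue A) (R + t + 1) * jwBent A R (t + 2))) +
      (qInt A (2 * R + 2) / (qInt A (R + t + 3) * qInt A (R - t))) •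
        (bent A R (t + 3) - bent A R (t + 2)) := by
  have h0 := hA.qInt_ne_zero (k := R + t + 3) (by omega)
  have h1 := hA.qInt_ne_zero (k := R - t) (by omega)
  have h2 := hA.qInt_ne_zero (k := R - (t + 1)) (by omega)
  have e1 : jw A (R + t + 2) * (cup K (R + t + 1) * cap (loopValue A) (R + t + 1) *
      bent A R (t + 2)) = 0 := by
    rw [bent, mul_smul_comm, mul_smul_comm, mul_assoc, ← mul_assoc (cap _ _),
      show R + t + 1 = R + (t + 1) by omega, cap_mul_bentCup_succ A (by omega), ← mul_assoc,
      ← mul_assoc, jw_mul_cup_mul_bentCup hA (by omega) (by omega) (by omega), zero_mul, smul_zero]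
  have e2 : bent A R (t + 2) * (cup K (R + t + 1) * cap (loopValue A) (R + t + 1) *
      jw A (R + t + 2)) = 0 := by
    rw [bent, smul_mul_assoc, mul_assoc, mul_assoc (cup _ _), ← mul_assoc (bentCap _ _ _),
      show R + t + 1 = R + (t + 1) by omega, bentCap_succ_mul_cup A (by omega),
      bentCap_mul_cap_mul_jw hA (by omega) (by omega) (by omega), mul_zero, smul_zero]
  have e3 := bent_succ hA (R := R) (t := t + 1) (by omega)
  have c := hA.qInt_mul_sub (R + t + 2) (R - (t + 1))
  rw [show R + t + 2 + (R - (t + 1)) + 1 = 2 * R + 2 by omega,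
    show R - (t + 1) + 1 = R - t by omega] at c
  rw [show R + 1 - (t + 1) = R - t by omega, show t + 1 + 2 = t + 3 by omega,
    show t + 1 + 1 = t + 2 by omega, ← add_assoc R t 1] at e3
  rw [jwBent, jwBent, show R + (t + 3) = R + t + 1 + 2 by omega, jw,
    show R + t + 1 + 1 = R + t + 2 by omega, show R + t + 1 + 2 = R + t + 3 by omega,
    show R + (t + 2) = R + t + 2 by omega, e3]
  generalize jw A (R + t + 2) = F at *
  generalize bent A R (t + 2) = P at *
  generalize cup K (R + t + 1) * cap (loopValue A) (R + t + 1) = U at *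
  simp only [add_mul, mul_add, e1, e2]
  match_scalars
  · simp
  · simp
  · simp
  · field_simp
    linear_combination c

end ArcSpace

/-! ## Comparison of the idempotents with their operators -/

namespace ArcSpace

open ArcDiagram

variable {R : Type} [CommRing R]

/-- The underlying function of `ArcDiagram.nest`. -/
def nestFun (l w s t x : ℕ) : ℕ :=
  if x < l then 2 * (l + w + s + t) - 1 - x else
    if x < l + 2 * s then 2 * (l + s) - 1 - x else
    if x < l + 2 * s + 2 * w then 2 * (l + 2 * s + w) - 1 - x else
    if x < l + 2 * s + 2 * w + 2 * t then 2 * (l + 2 * s + 2 * w + t) - 1 - x else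
    if x < 2 * (l + w + s + t) then 2 * (l + w + s + t) - 1 - x else x

theorem nestFun_spec (l w s t x : ℕ) :
    (x < l ∧ nestFun l w s t x = 2 * (l + w + s + t) - 1 - x) ∨
    (l ≤ x ∧ x < l + 2 * s ∧ nestFun l w s t x = 2 * (l + s) - 1 - x) ∨
    (l + 2 * s ≤ x ∧ x < l + 2 * s + 2 * w ∧
      nestFun l w s t x = 2 * (l + 2 * s + w) - 1 - x) ∨
    (l + 2 * s + 2 * w ≤ x ∧ x < l + 2 * s + 2 * w + 2 * t ∧
      nestFun l w s t x = 2 * (l + 2 * s + 2 * w + t) - 1 - x) ∨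
    (l + 2 * s + 2 * w + 2 * t ≤ x ∧ x < 2 * (l + w + s + t) ∧
      nestFun l w s t x = 2 * (l + w + s + t) - 1 - x) ∨
    (2 * (l + w + s + t) ≤ x ∧ nestFun l w s t x = x) := by
  unfold nestFun
  split_ifs <;> omega

theorem nestFun_involutive (l w s t x : ℕ) : nestFun l w s t (nestFun l w s t x) = x := by
  have h := nestFun_spec l w s t x
  have h' := nestFun_spec l w s t (nestFun l w s t x)
  generalize nestFun l w s t (nestFun l w s t x) = z at *
  generalize nestFun l w s t x = y at *
  omega

/-- The tangle with `l` vertical strands on the left, `w` on the right, `s` nested cups and `t`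
nested caps in between. -/
def _root_.ArcDiagram.nest (l w s t : ℕ) : ArcDiagram :=
  ⟨nestFun l w s t, nestFun_involutive l w s t⟩

/-- Joining the tops of two neighbouring vertical strands turns them into a cap around the `t` caps
already between them. -/
theorem cap_nest (δ : R) (l w t : ℕ) :
    cap δ l (Finsupp.single (nest (l + 1) (w + 1) 0 t) 1) =
      Finsupp.single (nest l w 0 (t + 1)) 1 := by
  have h1 := nestFun_spec (l + 1) (w + 1) 0 t l
  have h2 := nestFun_spec (l + 1) (w + 1) 0 t (l + 1)
  rw [cap_single]
  refine single_congr ?_ ?_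
  · funext x
    change capFun l (nestFun (l + 1) (w + 1) 0 t) x = nestFun l w 0 (t + 1) x
    have h3 := nestFun_spec (l + 1) (w + 1) 0 t (skip l 2 x)
    have h4 := nestFun_spec l w 0 (t + 1) x
    apply skip_injective l 2
    rw [skip_capFun, join]
    generalize nestFun (l + 1) (w + 1) 0 t (skip l 2 x) = a at *
    generalize nestFun (l + 1) (w + 1) 0 t l = b at *
    generalize nestFun (l + 1) (w + 1) 0 t (l + 1) = c at *
    generalize nestFun l w 0 (t + 1) x = d at *
    simp only [skip] at *
    split_ifs at * <;> omega
  · rw [loop, if_neg, pow_zero, one_mul]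
    change ¬ nestFun (l + 1) (w + 1) 0 t l = l + 1
    omega

theorem caps_nest (δ : R) (l s : ℕ) : ∀ t,
    caps δ l s (Finsupp.single (nest (l + s) s 0 t) 1) =
      Finsupp.single (nest l 0 0 (t + s)) 1 := by
  induction s with
  | zero => intro t; rfl
  | succ s ih =>
    intro t
    rw [caps, Module.End.mul_apply, ← add_assoc, cap_nest, ih, add_right_comm, add_assoc]

theorem cups_nest (l s t : ℕ) :
    cups R l s (Finsupp.single (nest l 0 0 t) 1) = Finsupp.single (nest l 0 s t) 1 := by
  induction s with
  | zero => rfl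
  | succ s ih =>
    rw [cups, Module.End.mul_apply, ih, cup_single]
    refine single_congr ?_ rfl
    funext x
    change cupFun (l + s) (nestFun l 0 s t) x = nestFun l 0 (s + 1) t x
    have h1 := nestFun_spec l 0 s t x
    have h2 := nestFun_spec l 0 s t (x - 2)
    have h3 := nestFun_spec l 0 (s + 1) t x
    simp only [cupFun, skip]
    split_ifs <;> omega

theorem isTangle_cups (δ : R) (l : ℕ) : ∀ s, TLHom.IsTangle δ l (l + (s + s)) (cups R l s)
  | 0 => .one l
  | s + 1 => by
    rw [cups, show l + (s + 1 + (s + 1)) = l + (s + s) + 2 by omega]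
    exact .mul (.cup (by omega)) (isTangle_cups δ l s)

theorem isTangle_caps (δ : R) (l : ℕ) : ∀ s, TLHom.IsTangle δ (l + (s + s)) l (caps δ l s)
  | 0 => .one l
  | s + 1 => by
    rw [caps, show l + (s + 1 + (s + 1)) = l + (s + s) + 2 by omega]
    exact .mul (isTangle_caps δ l s) (.cap (by omega))

theorem cups_succ (l : ℕ) : ∀ s, cups R l (s + 1) = cups R (l + 1) s * cup R l
  | 0 => by simp [cups]
  | s + 1 => by
    rw [cups, cups_succ l s, cups, mul_assoc, show l + (s + 1) = l + 1 + s by omega]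

theorem caps_succ (δ : R) (l : ℕ) : ∀ s, caps δ l (s + 1) = cap δ l * caps δ (l + 1) s
  | 0 => by simp [caps]
  | s + 1 => by
    rw [caps, caps_succ δ l s, caps, mul_assoc, show l + (s + 1) = l + 1 + s by omega]

end ArcSpace

namespace TLHom

open ArcSpace ArcDiagram

variable {R : Type} [CommRing R]

theorem comp_single_single (δ : R) {m n k : ℕ} (d : PlanarMatching (k + n))
    (e : PlanarMatching (n + m)) (a b : R) :
    comp δ (Finsupp.single d a) (Finsupp.single e b) = Finsupp.single (PlanarMatching.glue d e)
      (a * b * δ ^ PlanarMatching.loops d e) := by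
  simp [comp]

theorem tensor_single_single {m n m' n' : ℕ} (d : PlanarMatching (n + m))
    (e : PlanarMatching (n' + m')) (a b : R) :
    tensor (Finsupp.single d a) (Finsupp.single e b) =
      Finsupp.single (PlanarMatching.juxt d e) (a * b) := by
  simp [tensor]

theorem emb_id_tensor_cups_caps (δ : R) {l s n : ℕ} (hn : l + (s + s) = n) :
    emb ((id R l).tensor (comp δ (cups R s) (caps R s))) =
      (ArcSpace.cups R l s * ArcSpace.caps δ l s) (emb (id R n)) := by
  subst hn
  have e : (Finsupp.single (PlanarMatching.nested (l + (s + s))).toArc 1 : ArcSpace R) =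
      Finsupp.single (nest (l + s) s 0 0) 1 := by
    refine single_congr ?_ rfl
    funext x
    have := nestFun_spec (l + s) s 0 0 x
    simp only [PlanarMatching.nested, PlanarMatching.toArc, nest]
    split_ifs <;> omega
  have hc : comp δ (cups R s) (caps R s) = _ :=
    comp_single_single δ (m := s + s) (n := 0) (k := s + s) (PlanarMatching.nested s)
      ⟨(PlanarMatching.nested s).1, by rw [Nat.zero_add]; exact (PlanarMatching.nested s).2⟩ 1 1
  rw [Module.End.mul_apply, emb_id, e, caps_nest, cups_nest, Nat.zero_add, hc, id,
    tensor_single_single, emb_single]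
  refine single_congr ?_ (by simp [PlanarMatching.loops, PlanarMatching.loopsMany])
  funext x
  have := nestFun_spec l 0 s s x
  simp only [PlanarMatching.juxt, PlanarMatching.toArc, PlanarMatching.glue,
    PlanarMatching.closeMany, PlanarMatching.stack, PlanarMatching.insertAt, nest,
    PlanarMatching.nested]
  split_ifs <;> omega

end TLHom

namespace ArcSpace

variable {K : Type} [Field K]

theorem isTangle_cup_cap (δ : K) (k : ℕ) :
    TLHom.IsTangle δ (k + 2) (k + 2) (cup K k * cap δ k) :=
  .mul (.cup le_rfl) (.cap le_rfl)

theorem isTangle_jw (A : K) : ∀ n, TLHom.IsTangle (loopValue A) n n (jw A n)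
  | 0 => .one 0
  | 1 => .one 1
  | k + 2 => by
    have h := (isTangle_jw A (k + 1)).add_right 1
    exact .add h (.smul _ (.mul h (.mul (isTangle_cup_cap _ k) h)))

theorem isTangle_jw_of_le (A : K) {k n : ℕ} (h : k ≤ n) :
    TLHom.IsTangle (loopValue A) n n (jw A k) := by
  obtain ⟨s, rfl⟩ := Nat.exists_eq_add_of_le h
  exact (isTangle_jw A k).add_right s

/-- Translates the recursive definition: each factor is an operator applied to the identity, hence
acts by composition as that operator. -/
theorem emb_jonesWenzl (A : K) : ∀ n,
    TLHom.emb (jonesWenzl A n) = jw A n (TLHom.emb (TLHom.id K n))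
  | 0 => rfl
  | 1 => rfl
  | k + 2 => by
    have hF := (isTangle_jw A (k + 1)).emb_tensor_id (emb_jonesWenzl A (k + 1)) 1
    have h := isTangle_jw_of_le A (show k + 1 ≤ k + 2 by omega)
    have he := TLHom.emb_id_tensor_cups_caps (loopValue A) (show k + (1 + 1) = k + 2 by rfl)
    have hc : cups K k 1 * caps (loopValue A) k 1 = cup K k * cap (loopValue A) k := by
      simp [cups, caps]
    rw [hc] at he
    rw [jonesWenzl, map_add, map_smul, h.emb_comp hF, (isTangle_cup_cap _ k).emb_comp he, hF]
    rfl

theorem bentCup_eq (A : K) {R : ℕ} : ∀ {s : ℕ}, s ≤ R →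
    bentCup A R s = jw A R * cups K (R - s) s
  | 0, _ => by simp [bentCup, cups]
  | s + 1, h => by
    rw [bentCup, bentCup_eq A (by omega), cups_succ, mul_assoc,
      show R - (s + 1) = R - 1 - s by omega, show R - s = R - 1 - s + 1 by omega]

theorem bentCap_eq (A : K) {R : ℕ} : ∀ {s : ℕ}, s ≤ R →
    bentCap A R s = caps (loopValue A) (R - s) s * jw A R
  | 0, _ => by simp [bentCap, caps]
  | s + 1, h => by
    rw [bentCap, bentCap_eq A (by omega), caps_succ, mul_assoc,
      show R - (s + 1) = R - 1 - s by omega, show R - s = R - 1 - s + 1 by omega]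

theorem emb_hMor (A : K) {r n : ℕ} (h₁ : r ≤ n) (h₂ : n + 2 ≤ 2 * r) :
    TLHom.emb (hMor A r n h₁ h₂) = ((-1) ^ n * qInt A (2 * r - n - 1)) •
      (bentCup A (r - 1) (n + 1 - r) * bentCap A (r - 1) (n + 1 - r)) (TLHom.emb (TLHom.id K n)) := by
  have hF : TLHom.emb (TLHom.cast (show r - 1 + (n + 1 - r) = n by omega)
      (show r - 1 + (n + 1 - r) = n by omega)
      ((jonesWenzl A (r - 1)).tensor (TLHom.id K (n + 1 - r)))) =
      jw A (r - 1) (TLHom.emb (TLHom.id K n)) := by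
    rw [TLHom.emb_cast, (isTangle_jw A (r - 1)).emb_tensor_id (emb_jonesWenzl A (r - 1)),
      show r - 1 + (n + 1 - r) = n by omega]
  have hn : 2 * r - n - 2 + (n + 1 - r + (n + 1 - r)) = n := by omega
  have he : TLHom.emb (TLHom.cast hn hn ((TLHom.id K (2 * r - n - 2)).tensor
      (TLHom.comp (loopValue A) (TLHom.cups K (n + 1 - r)) (TLHom.caps K (n + 1 - r))))) =
      (cups K (2 * r - n - 2) (n + 1 - r) * caps (loopValue A) (2 * r - n - 2) (n + 1 - r))
        (TLHom.emb (TLHom.id K n)) := by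
    rw [TLHom.emb_cast, TLHom.emb_id_tensor_cups_caps _ hn]
  have h := isTangle_jw_of_le A (show r - 1 ≤ n by omega)
  have h' := (isTangle_cups (loopValue A) (2 * r - n - 2) (n + 1 - r)).mul
    (isTangle_caps (loopValue A) (2 * r - n - 2) (n + 1 - r))
  rw [hn] at h'
  rw [hMor, map_smul, h.emb_comp hF, h'.emb_comp he, hF, bentCup_eq A (by omega),
    bentCap_eq A (by omega), show r - 1 - (n + 1 - r) = 2 * r - n - 2 by omega]
  rfl

/-- Evenness of `R` reconciles the sign (-1)^(R+s) of h with the sign (-1)^s in `bent`. -/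
theorem emb_gMor (A : K) {R s : ℕ} (hR : Even R) (h₁ : R + 1 ≤ R + s)
    (h₂ : R + s + 2 ≤ 2 * (R + 1)) :
    TLHom.emb (gMor A (R + 1) (R + s) h₁ h₂) =
      jwBent A R s (TLHom.emb (TLHom.id K (R + s))) := by
  rw [gMor, map_add, map_smul, emb_jonesWenzl, emb_hMor, jwBent, bent, smul_smul,
    show R + 1 - 1 = R by omega, show R + s + 1 - (R + 1) = s by omega,
    show 2 * (R + 1) - (R + s) - 1 = R + 1 - s by omega, pow_add, hR.neg_one_pow, one_mul,
    inv_mul_eq_div]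
  rfl

end ArcSpace

/-! ## Integrality -/

namespace ArcSpace

variable {K : Type} [Field K]

/-- The operators which preserve the combinations of arc diagrams with coefficients in `S`. -/
def integralOps (S : Subring K) : Subring (Module.End K (ArcSpace K)) where
  carrier := {T | ∀ z : ArcSpace K, (∀ σ, z σ ∈ S) → ∀ σ, T z σ ∈ S}
  mul_mem' hT hT' z hz := hT _ (hT' z hz)
  one_mem' _ hz := hz
  add_mem' hT hT' z hz σ := S.add_mem (hT z hz σ) (hT' z hz σ)
  zero_mem' _ _ _ := S.zero_mem
  neg_mem' hT z hz σ := S.neg_mem (hT z hz σ)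

variable {S : Subring K}

theorem smul_mem_integralOps {c : K} (hc : c ∈ S) {T : Module.End K (ArcSpace K)}
    (hT : T ∈ integralOps S) : c • T ∈ integralOps S := fun z hz σ =>
  S.mul_mem hc (hT z hz σ)

theorem mem_integralOps {f : ArcDiagram → ArcSpace K} (hf : ∀ τ σ, f τ σ ∈ S) :
    Finsupp.linearCombination K f ∈ integralOps S := by
  intro z hz σ
  rw [Finsupp.linearCombination_apply, Finsupp.sum_apply]
  exact S.sum_mem fun τ _ => S.mul_mem (hz τ) (hf τ σ)

theorem single_mem {c : K} (hc : c ∈ S) (τ σ : ArcDiagram) :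
    (Finsupp.single τ c : ArcSpace K) σ ∈ S := by
  classical
  rw [Finsupp.single_apply]
  split_ifs
  · exact hc
  · exact S.zero_mem

theorem cap_mem {δ : K} (hδ : δ ∈ S) (i : ℕ) : cap δ i ∈ integralOps S :=
  mem_integralOps fun _ σ => single_mem (S.pow_mem hδ _) _ σ

theorem cup_mem (S : Subring K) (i : ℕ) : cup K i ∈ integralOps S :=
  mem_integralOps fun _ σ => single_mem S.one_mem _ σ

variable {A : K} {R : ℕ}

theorem loopValue_mem (h : ∀ k, qInt A k ∈ S) : loopValue A ∈ S := S.neg_mem (h 2)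

theorem cup_mul_cap_mem (h : ∀ k, qInt A k ∈ S) (i : ℕ) :
    cup K i * cap (loopValue A) i ∈ integralOps S :=
  mul_mem (cup_mem S i) (cap_mem (loopValue_mem h) i)

theorem jw_mem (h : ∀ k, qInt A k ∈ S) (h' : ∀ k, 0 < k → k ≤ R → (qInt A k)⁻¹ ∈ S) :
    ∀ k ≤ R, jw A k ∈ integralOps S
  | 0, _ => one_mem _
  | 1, _ => one_mem _
  | k + 2, hk => by
    have ih := jw_mem h h' (k + 1) (by omega)
    rw [jw, div_eq_mul_inv]
    exact add_mem ih (smul_mem_integralOps (S.mul_mem (h _) (h' _ (by omega) hk))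
      (mul_mem ih (mul_mem (cup_mul_cap_mem h k) ih)))

theorem bentCup_mem (h : ∀ k, qInt A k ∈ S) (hR : jw A R ∈ integralOps S) :
    ∀ s, bentCup A R s ∈ integralOps S
  | 0 => hR
  | s + 1 => mul_mem (bentCup_mem h hR s) (cup_mem S _)

theorem bentCap_mem (h : ∀ k, qInt A k ∈ S) (hR : jw A R ∈ integralOps S) :
    ∀ s, bentCap A R s ∈ integralOps S
  | 0 => hR
  | s + 1 => mul_mem (cap_mem (loopValue_mem h) _) (bentCap_mem h hR s)

theorem smul_bent_mem (h : ∀ k, qInt A k ∈ S) (hR : jw A R ∈ integralOps S)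
    (h2 : qInt A (2 * R + 2) / qInt A (R + 1) ∈ S) (s : ℕ) :
    qInt A (2 * R + 2) • bent A R s ∈ integralOps S := by
  rw [bent, smul_smul]
  refine smul_mem_integralOps ?_ (mul_mem (bentCup_mem h hR s) (bentCap_mem h hR s))
  rw [mul_div_assoc', mul_comm (qInt A (2 * R + 2)), ← mul_div_assoc']
  exact S.mul_mem (S.mul_mem (S.pow_mem (S.neg_mem S.one_mem) _) (h _)) h2

/-- Only `bent` carries the denominator [R+1], and in the recursion it always comes with the factor
[2R+2]; `h2` says that their quotient is integral. -/
theorem jwBent_mem (hA : IsGeneric A) (h : ∀ k, qInt A k ∈ S)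
    (h' : ∀ k, 0 < k → k < 2 * R + 2 → k ≠ R + 1 → (qInt A k)⁻¹ ∈ S)
    (h2 : qInt A (2 * R + 2) / qInt A (R + 1) ∈ S) (hR : 2 ≤ R) :
    ∀ s, 1 ≤ s → s ≤ R + 1 → jwBent A R s ∈ integralOps S
  | 0, h, _ => by omega
  | 1, _, _ => by
    rw [jwBent_one A (by omega)]
    exact jw_mem h (fun k h0 h1 => h' k h0 (by omega) (by omega)) R le_rfl
  | 2, _, _ => by
    have hF := jw_mem h (fun k h0 h1 => h' k h0 (by omega) (by omega)) R le_rfl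
    have hH := mul_mem (bentCup_mem h hF 1) (bentCap_mem h hF 1)
    have hU := cup_mul_cap_mem h R
    have hi := h' (R + 2) (by omega) (by omega) (by omega)
    rw [jwBent_two hA (by omega)]
    simp only [div_eq_mul_inv]
    exact add_mem (add_mem (add_mem hF (smul_mem_integralOps (S.mul_mem (h _) hi)
      (mul_mem hF (mul_mem hU hF)))) (smul_mem_integralOps (S.mul_mem (h _) hi)
      (add_mem (mul_mem hH (mul_mem hU hF)) (mul_mem hF (mul_mem hU hH)))))
      (smul_mem_integralOps (S.mul_mem (S.mul_mem (h _) (h _)) hi)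
      (mul_mem hH (mul_mem hU hH)))
  | t + 3, _, ht => by
    have hF := jw_mem h (fun k h0 h1 => h' k h0 (by omega) (by omega)) R le_rfl
    have ih := jwBent_mem hA h h' h2 hR (t + 2) (by omega) (by omega)
    have hU := cup_mul_cap_mem h (R + t + 1)
    have hi := h' (R + t + 3) (by omega) (by omega) (by omega)
    have hj := h' (R - t) (by omega) (by omega) (by omega)
    rw [jwBent_succ hA (by omega)]
    refine add_mem (add_mem ih (smul_mem_integralOps ?_ (mul_mem ih (mul_mem hU ih)))) ?_
    · rw [div_eq_mul_inv]
      exact S.mul_mem (h _) hi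
    · have e : qInt A (2 * R + 2) • (bent A R (t + 3) - bent A R (t + 2)) =
          qInt A (2 * R + 2) • bent A R (t + 3) - qInt A (2 * R + 2) • bent A R (t + 2) := by
        module
      rw [div_eq_mul_inv, mul_comm, mul_smul, e, mul_inv]
      exact smul_mem_integralOps (S.mul_mem hi hj) (sub_mem (smul_bent_mem h hF h2 _)
        (smul_bent_mem h hF h2 _))

/-- The coefficient of `bent A R (R + 1)` contains [0], so the recursion for g also reaches
f_{2r-1}. -/
theorem jwBent_last (A : K) (R : ℕ) : jwBent A R (R + 1) = jw A (2 * R + 1) := by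
  rw [jwBent, bent, Nat.sub_self, qInt_zero, mul_zero, zero_div, zero_smul, add_zero,
    show R + (R + 1) = 2 * R + 1 by omega]

end ArcSpace

/-! ## Rational functions without a pole at a given point -/

/-- The rational functions without a pole at `a`. -/
def regularSubring (a : ℂ) : Subring (RatFunc ℂ) where
  carrier := {x | x.denom.eval a ≠ 0}
  mul_mem' {x y} hx hy h := by
    obtain ⟨p, hp⟩ := RatFunc.denom_mul_dvd x y
    have := congrArg (Polynomial.eval a) hp
    rw [Polynomial.eval_mul, Polynomial.eval_mul, h, zero_mul] at this
    exact mul_ne_zero hx hy this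
  one_mem' := by simp
  add_mem' {x y} hx hy h := by
    obtain ⟨p, hp⟩ := RatFunc.denom_add_dvd x y
    have := congrArg (Polynomial.eval a) hp
    rw [Polynomial.eval_mul, Polynomial.eval_mul, h, zero_mul] at this
    exact mul_ne_zero hx hy this
  zero_mem' := by simp
  neg_mem' {x} hx h := by
    have hd := RatFunc.denom_mul_dvd (-1) x
    rw [neg_one_mul] at hd
    obtain ⟨p, hp⟩ := hd
    have hc : (-1 : RatFunc ℂ).denom = 1 := by
      have := RatFunc.denom_C (-1 : ℂ)
      rwa [map_neg, map_one] at this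
    have := congrArg (Polynomial.eval a) hp
    rw [Polynomial.eval_mul, Polynomial.eval_mul, h, zero_mul, hc, Polynomial.eval_one,
      one_mul] at this
    exact hx this

theorem div_mem_regularSubring {a : ℂ} {p q : Polynomial ℂ} (hq : q.eval a ≠ 0) :
    algebraMap (Polynomial ℂ) (RatFunc ℂ) p / algebraMap _ _ q ∈ regularSubring a := by
  intro h
  have hq0 : q ≠ 0 := by rintro rfl; simp at hq
  obtain ⟨d, hd⟩ := RatFunc.denom_div_dvd p q
  rw [hd, Polynomial.eval_mul, h, zero_mul] at hq
  exact hq rfl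

theorem isGeneric_X : IsGeneric (RatFunc.X : RatFunc ℂ) := by
  refine ⟨RatFunc.X_ne_zero, fun k hk h => ?_⟩
  rw [← RatFunc.algebraMap_X, ← map_pow, ← map_one (algebraMap (Polynomial ℂ) (RatFunc ℂ))] at h
  have := congrArg Polynomial.natDegree (RatFunc.algebraMap_injective ℂ h)
  simp at this
  omega

theorem qInt_X_eq (k : ℕ) : qInt (RatFunc.X : RatFunc ℂ) k =
    algebraMap (Polynomial ℂ) (RatFunc ℂ) (Polynomial.X ^ 2 * (Polynomial.X ^ (4 * k) - 1)) /
      algebraMap (Polynomial ℂ) (RatFunc ℂ) (Polynomial.X ^ (2 * k) * (Polynomial.X ^ 4 - 1)) := by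
  rw [qInt_eq isGeneric_X.1 isGeneric_X.pow_four_ne_one]
  simp [RatFunc.algebraMap_X]

theorem qInt_X_mem {a : ℂ} (ha : a ≠ 0) (h4 : a ^ 4 ≠ 1) (k : ℕ) :
    qInt (RatFunc.X : RatFunc ℂ) k ∈ regularSubring a := by
  rw [qInt_X_eq]
  apply div_mem_regularSubring
  simp [ha, sub_eq_zero, h4]

theorem inv_qInt_X_mem {a : ℂ} (ha : a ≠ 0) {k : ℕ} (h4 : a ^ (4 * k) ≠ 1) :
    (qInt (RatFunc.X : RatFunc ℂ) k)⁻¹ ∈ regularSubring a := by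
  rw [qInt_X_eq, inv_div]
  apply div_mem_regularSubring
  simp [ha, sub_eq_zero, h4]

/-- The quotient is A^(2k) + A^(-2k), whatever the value of [k] at `a`. -/
theorem qInt_X_div_mem {a : ℂ} (ha : a ≠ 0) {k : ℕ} (hk : 0 < k) :
    qInt (RatFunc.X : RatFunc ℂ) (2 * k) / qInt RatFunc.X k ∈ regularSubring a := by
  have h0 := isGeneric_X.qInt_ne_zero hk
  have hX := isGeneric_X.1
  have e : qInt (RatFunc.X : RatFunc ℂ) (2 * k) / qInt RatFunc.X k =
      algebraMap (Polynomial ℂ) (RatFunc ℂ) (Polynomial.X ^ (4 * k) + 1) /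
        algebraMap (Polynomial ℂ) (RatFunc ℂ) (Polynomial.X ^ (2 * k)) := by
    have h1 := isGeneric_X.2 k hk
    have h4 := isGeneric_X.pow_four_ne_one
    rw [qInt_eq hX h4, qInt_eq hX h4]
    simp only [map_add, map_pow, map_one, RatFunc.algebraMap_X]
    have h1' := sub_ne_zero.2 h1
    have h4' := sub_ne_zero.2 h4
    rw [show 4 * (2 * k) = 4 * k + 4 * k by ring, show 2 * (2 * k) = 2 * k + 2 * k by ring,
      pow_add, pow_add]
    have hx : (RatFunc.X : RatFunc ℂ) ^ (2 * k) ≠ 0 := pow_ne_zero _ hX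
    generalize (RatFunc.X : RatFunc ℂ) ^ (4 * k) = y at *
    generalize (RatFunc.X : RatFunc ℂ) ^ (2 * k) = x at *
    field_simp
    ring
  rw [e]
  apply div_mem_regularSubring
  simp [ha]

/-! ## Regularity of the idempotents -/

theorem specialA_ne_zero (r : ℕ) : specialA r ≠ 0 := pow_ne_zero _ (Complex.exp_ne_zero _)

/-- Twice the exponent is r + 1, and q^r = 1. -/
theorem specialA_sq {r : ℕ} (hodd : Odd r) :
    specialA r ^ 2 = Complex.exp (2 * Real.pi * Complex.I / r) := by
  obtain ⟨k, rfl⟩ := hodd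
  have h := (Complex.isPrimitiveRoot_exp (2 * k + 1) (by omega)).pow_eq_one
  rw [specialA, ← pow_mul, show (2 * k + 1 + 1) / 2 * 2 = 2 * k + 1 + 1 by omega, pow_succ, h,
    one_mul]

/-- The left-hand power is q^(2k), and 2 is invertible modulo the odd number `r`. -/
theorem specialA_pow_eq_one {r : ℕ} (hodd : Odd r) (k : ℕ) :
    specialA r ^ (4 * k) = 1 ↔ r ∣ k := by
  have h := Complex.isPrimitiveRoot_exp r hodd.pos.ne'
  rw [show 4 * k = 2 * (2 * k) by ring, pow_mul, specialA_sq hodd, h.pow_eq_one_iff_dvd]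
  exact ⟨fun h => (Nat.Coprime.dvd_mul_left (Nat.coprime_two_right.2 hodd)).1 h,
    fun h => h.mul_left 2⟩

namespace TLHom

open ArcSpace

theorem regularAt_of_emb {a : ℂ} {n : ℕ} {x : TLHom (RatFunc ℂ) n n}
    {T : Module.End (RatFunc ℂ) (ArcSpace (RatFunc ℂ))} (hx : emb x = T (emb (id _ n)))
    (hT : T ∈ integralOps (regularSubring a)) : x.RegularAt a := by
  intro d
  rw [← emb_apply, hx, emb_id]
  exact hT _ (single_mem (Subring.one_mem _) _) _

end TLHom

section Regular

open ArcSpace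

theorem qInt_mem_of_odd {R : ℕ} (hR : 2 ≤ R) (hodd : Odd (R + 1)) (k : ℕ) :
    qInt (RatFunc.X : RatFunc ℂ) k ∈ regularSubring (specialA (R + 1)) := by
  refine qInt_X_mem (specialA_ne_zero _) ?_ k
  rw [← mul_one 4, Ne, specialA_pow_eq_one hodd]
  intro h
  have := Nat.le_of_dvd one_pos h
  omega

theorem inv_qInt_mem_of_odd {R : ℕ} (hodd : Odd (R + 1)) {k : ℕ} (h0 : 0 < k)
    (h1 : k < 2 * R + 2) (h2 : k ≠ R + 1) :
    (qInt (RatFunc.X : RatFunc ℂ) k)⁻¹ ∈ regularSubring (specialA (R + 1)) := by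
  refine inv_qInt_X_mem (specialA_ne_zero _) ?_
  rw [Ne, specialA_pow_eq_one hodd]
  rintro ⟨c, rfl⟩
  have : c < 2 := by
    by_contra hc
    have := Nat.mul_le_mul_left (R + 1) (show 2 ≤ c by omega)
    omega
  interval_cases c <;> omega

theorem jwBent_mem_of_odd {R : ℕ} (hR : 2 ≤ R) (hodd : Odd (R + 1)) {s : ℕ} (h1 : 1 ≤ s)
    (h2 : s ≤ R + 1) : jwBent (RatFunc.X : RatFunc ℂ) R s ∈
      integralOps (regularSubring (specialA (R + 1))) := by
  have h := qInt_X_div_mem (specialA_ne_zero (R + 1)) (show 0 < R + 1 by omega)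
  rw [show 2 * (R + 1) = 2 * R + 2 by ring] at h
  exact jwBent_mem isGeneric_X (qInt_mem_of_odd hR hodd) (fun _ => inv_qInt_mem_of_odd hodd)
    h hR s h1 h2

theorem fGen_regularAt {R : ℕ} (hR : 2 ≤ R) (hodd : Odd (R + 1)) :
    (fGen (2 * R + 1)).RegularAt (specialA (R + 1)) :=
  TLHom.regularAt_of_emb (emb_jonesWenzl _ _)
    (jwBent_last (RatFunc.X : RatFunc ℂ) R ▸ jwBent_mem_of_odd hR hodd (by omega) le_rfl)

theorem tGen_regularAt {R : ℕ} (hR : 2 ≤ R) (hodd : Odd (R + 1)) (n : ℕ)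
    (hn : n < 2 * (R + 1) - 1) : (tGen (R + 1) n hn).RegularAt (specialA (R + 1)) := by
  rw [tGen]
  split_ifs with h
  · obtain ⟨s, rfl⟩ : ∃ s, n = R + s := ⟨n - R, by omega⟩
    have hE : Even R := by
      by_contra hE
      rw [Nat.not_even_iff_odd] at hE
      exact Nat.not_odd_iff_even.2 hE.add_one hodd
    exact TLHom.regularAt_of_emb (emb_gMor _ hE _ _)
      (jwBent_mem_of_odd hR hodd (by omega) (by omega))
  · exact TLHom.regularAt_of_emb (emb_jonesWenzl _ _) (jw_mem (qInt_mem_of_odd hR hodd)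
      (fun k h0 h1 => inv_qInt_mem_of_odd hodd h0 (by omega) (by omega)) n (show n ≤ R by omega))

end Regular

/-! ## The coefficient of the identity -/

namespace ArcSpace

open ArcDiagram

variable {K : Type} [Field K]

/-- The bound puts both ends of the new arc among the top points, whereas vertical strands join top
points to bottom ones. -/
theorem cup_apply_nested {i n : ℕ} (h : i + 2 ≤ n) (z : ArcSpace K) :
    cup K i z (PlanarMatching.nested n).toArc = 0 := by
  induction z using Finsupp.induction_linear with
  | zero => simp
  | add z w hz hw => rw [map_add, Finsupp.add_apply, hz, hw, add_zero]
  | single σ c =>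
    rw [cup_single, Finsupp.single_eq_of_ne]
    intro e
    have h1 : (if i < n + n then n + n - 1 - i else i) = cupFun i σ.1 i :=
      congrFun (congrArg Subtype.val e) i
    rw [cupFun_self, if_pos (by omega)] at h1
    omega

/-- Every correction term is `jw A (k + 1)` after a cup; by induction the former preserves the
coefficient of the identity, and the latter makes it zero. -/
theorem jw_apply_nested (A : K) {n : ℕ} : ∀ {k : ℕ}, k ≤ n → ∀ z : ArcSpace K,
    jw A k z (PlanarMatching.nested n).toArc = z (PlanarMatching.nested n).toArc
  | 0, _, _ => rfl
  | 1, _, _ => rfl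
  | k + 2, h, z => by
    rw [jw, LinearMap.add_apply, Finsupp.add_apply, jw_apply_nested A (by omega),
      LinearMap.smul_apply, Finsupp.smul_apply, Module.End.mul_apply,
      jw_apply_nested A (by omega), mul_assoc, Module.End.mul_apply, cup_apply_nested h,
      smul_zero, add_zero]

theorem jwBent_apply_nested (A : K) {R s : ℕ} (h : 1 ≤ s) (hs : s ≤ R) (z : ArcSpace K) :
    jwBent A R s z (PlanarMatching.nested (R + s)).toArc =
      z (PlanarMatching.nested (R + s)).toArc := by
  obtain ⟨s, rfl⟩ : ∃ j, s = j + 1 := ⟨s - 1, by omega⟩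
  rw [jwBent, LinearMap.add_apply, Finsupp.add_apply, jw_apply_nested A le_rfl, bent,
    LinearMap.smul_apply, Finsupp.smul_apply, bentCup_eq A hs, cups, mul_assoc, mul_assoc,
    Module.End.mul_apply, jw_apply_nested A (by omega), Module.End.mul_apply,
    cup_apply_nested (by omega), smul_zero, add_zero]

end ArcSpace

theorem even_of_odd_succ {R : ℕ} (h : Odd (R + 1)) : Even R := by
  obtain ⟨k, hk⟩ := h
  exact ⟨k, by omega⟩

theorem fGen_nested (n : ℕ) : fGen n (PlanarMatching.nested n) = 1 := by
  rw [← TLHom.emb_apply, fGen, ArcSpace.emb_jonesWenzl, ArcSpace.jw_apply_nested _ le_rfl,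
    TLHom.emb_id, Finsupp.single_eq_same]

theorem tGen_nested {r : ℕ} (hodd : Odd r) (n : ℕ) (hn : n < 2 * r - 1) :
    tGen r n hn (PlanarMatching.nested n) = 1 := by
  obtain ⟨R, rfl⟩ : ∃ R, r = R + 1 := ⟨r - 1, by have := hodd.pos; omega⟩
  rw [tGen]
  split_ifs with h
  · obtain ⟨s, rfl⟩ : ∃ s, n = R + s := ⟨n - R, by omega⟩
    rw [← TLHom.emb_apply, ArcSpace.emb_gMor _ (even_of_odd_succ hodd),
      ArcSpace.jwBent_apply_nested _ (by omega) (by omega), TLHom.emb_id, Finsupp.single_eq_same]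
  · exact fGen_nested n

theorem TLHom.specialize_nested {a : ℂ} {n : ℕ} {x : TLHom (RatFunc ℂ) n n}
    (h : x (PlanarMatching.nested n) = 1) : x.specialize a (PlanarMatching.nested n) = 1 := by
  rw [specialize, Finsupp.mapRange_apply, h, RatFunc.eval_one]

/-! ## Non-identity diagrams factor through fewer points -/

theorem PlanarMatching.exists_arc_of_ne_nested {n : ℕ} {d : PlanarMatching (n + n)}
    (h : d ≠ nested n) : ∃ i, i + 1 < n ∧ d.1 i = i + 1 := by
  obtain ⟨σ, h1, h2, h3, h4⟩ := d
  by_contra! hno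
  simp only at hno
  -- Innermost-arc argument: an arc of length at least 2 between top points encloses the strictly
  -- shorter arc which starts at `x + 1`.
  have key : ∀ l x, x + l < n → σ x ≠ x + l := by
    intro l
    induction l using Nat.strong_induction_on with
    | _ l ih =>
      intro x hx e
      have := (h2 x (by omega)).2
      obtain rfl | hl : l = 1 ∨ 2 ≤ l := by
        rcases l with _ | _ | l
        · omega
        · exact Or.inl rfl
        · exact Or.inr (by omega)
      · exact hno x hx e
      · have := h4 x (x + 1) (by omega) (by omega)
        have := h2 (x + 1) (by omega)
        exact ih (σ (x + 1) - (x + 1)) (by omega) (x + 1) (by omega) (by omega)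
  have htop : ∀ x < n, n ≤ σ x := by
    intro x hx
    by_contra! hlt
    obtain hle | hle := le_total x (σ x)
    · exact key (σ x - x) x (by omega) (by omega)
    · have := h3 x
      exact key (x - σ x) (σ x) (by omega) (by omega)
  have hanti : ∀ x y, x < y → y < n → σ y < σ x := fun x y hxy hy =>
    (h4 x y hxy (lt_of_lt_of_le hy (htop x (by omega)))).2
  -- A strictly decreasing sequence of n values in [n, 2n) is determined: `hle` bounds it above from
  -- the left end, `hge` below from the right end.
  have hle : ∀ x < n, σ x + x + 1 ≤ n + n := by
    intro x
    induction x with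
    | zero => intro hx; have := (h2 0 (by omega)).1; omega
    | succ x ih =>
      intro hx
      have := ih (by omega)
      have := hanti x (x + 1) (by omega) hx
      omega
  have hge : ∀ k < n, n + k ≤ σ (n - 1 - k) := by
    intro k
    induction k with
    | zero => intro hx; exact htop _ (by omega)
    | succ k ih =>
      intro hk
      have := ih (by omega)
      have := hanti (n - 1 - (k + 1)) (n - 1 - k) (by omega) (by omega)
      omega
  have heq : ∀ x < n, σ x = n + n - 1 - x := by
    intro x hx
    have := hge (n - 1 - x) (by omega)
    rw [show n - 1 - (n - 1 - x) = x by omega] at this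
    have := hle x hx
    omega
  apply h
  apply Subtype.ext
  funext x
  change σ x = if x < n + n then n + n - 1 - x else x
  split_ifs with hx
  · by_cases hxn : x < n
    · exact heq x hxn
    · have := heq (n + n - 1 - x) (by omega)
      rw [show n + n - 1 - (n + n - 1 - x) = x by omega] at this
      rw [← this, h3, this]
  · exact h1 x (by omega)

theorem ArcDiagram.cupFun_capFun {i : ℕ} {σ : ℕ → ℕ} (h : ∀ x, σ (σ x) = x) (hi : σ i = i + 1) :
    cupFun i (capFun i σ) = σ := by
  have hi' : σ (i + 1) = i := by rw [← hi, h]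
  funext x
  obtain rfl | rfl | ⟨y, rfl⟩ := eq_or_eq_skip i x
  · rw [cupFun_self, hi]
  · rw [cupFun_succ, hi']
  · have hy := skip_ne i y
    have h' := h (skip i 2 y)
    rw [cupFun_skip, skip_capFun, join]
    have n1 : σ (skip i 2 y) ≠ i := fun e => by rw [e, hi] at h'; exact hy.2 h'.symm
    have n2 : σ (skip i 2 y) ≠ i + 1 := fun e => by rw [e, hi'] at h'; exact hy.1 h'.symm
    simp [n1, n2]

/-- Cut off the arc at the top: the diagram is that cup placed on top of what remains after removing
the arc. -/
theorem TLHom.exists_comp_eq_single {R : Type} [CommRing R] (δ : R) {m i : ℕ} (hi : i ≤ m)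
    (d : PlanarMatching (m + 2 + (m + 2))) (hd : d.1 i = i + 1) :
    ∃ (v : TLHom R m (m + 2)) (u : TLHom R (m + 2) m), Finsupp.single d 1 = comp δ v u := by
  have hp : IsPlanarMatching (m + (m + 2) + 2) d.1 := by
    rw [show m + (m + 2) + 2 = m + 2 + (m + 2) by omega]
    exact d.2
  obtain ⟨v, -, hv, -⟩ := (IsTangle.cup (δ := δ) hi).exists_apply (id R m)
  obtain ⟨e, he⟩ : ∃ e : PlanarMatching (m + (m + 2)), e.1 = PlanarMatching.closeAt i d.1 :=
    ⟨⟨_, PlanarMatching.closeAt_isPlanar hp (by omega)⟩, rfl⟩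
  refine ⟨v, Finsupp.single e 1, ?_⟩
  apply emb_injective
  rw [hv, id_comp, emb_single, emb_single, ArcSpace.cup_single]
  refine ArcSpace.single_congr ?_ rfl
  change d.1 = ArcDiagram.cupFun i e.1
  rw [he, ← ArcSpace.capFun_eq_closeAt hp (by omega), ArcDiagram.cupFun_capFun d.2.2.2.1 hd]

/-! ## Decomposition of identities in the extended category -/

namespace ExtHom

variable {r : ℕ}

/-- The inclusion of the Temperley–Lieb category as a linear map. -/
def ofTLₗ (r m n : ℕ) : TLHom ℂ m n →ₗ[ℂ] ExtHom r m n where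
  toFun := ofTL r
  map_add' s t := Quot.sound (.ofTL_add s t)
  map_smul' c t := Quot.sound (.ofTL_smul c t)

/-- The linear map `x ↦ x ⊗ id_l`. -/
def tensorId (l : ℕ) {m n : ℕ} : ExtHom r m n →ₗ[ℂ] ExtHom r (m + l) (n + l) where
  toFun := Quot.map (fun u => .tensor u (.id r l)) fun _ _ h => .tensor_left _ h
  map_add' := by
    rintro ⟨u⟩ ⟨v⟩
    exact Quot.sound (.add_tensor u v _)
  map_smul' := by
    rintro c ⟨u⟩
    exact Quot.sound (.smul_tensor c u _)

theorem tensorId_comp (l : ℕ) {m n k : ℕ} (v : ExtHom r n k) (u : ExtHom r m n) :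
    tensorId l (comp v u) = comp (tensorId l v) (tensorId l u) := by
  obtain ⟨v⟩ := v
  obtain ⟨u⟩ := u
  exact (Quot.sound (.tensor_right _ (.id_comp (ExtTerm.id r l)))).symm.trans
    (Quot.sound (.interchange v u (.id r l) (.id r l)))

theorem tensorId_id (l m : ℕ) :
    tensorId l (ofTL r (TLHom.id ℂ m)) = ofTL r (TLHom.id ℂ (m + l)) := by
  rw [← TLHom.id_tensor_id]
  exact (Quot.sound (.ofTL_tensor (TLHom.id ℂ m) (TLHom.id ℂ l))).symm

/-- Transport along an equality of sources. -/
def castSource {m m' n : ℕ} (h : m = m') : ExtHom r m n →ₗ[ℂ] ExtHom r m' n where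
  toFun x := h ▸ x
  map_add' := by subst h; intros; rfl
  map_smul' := by subst h; intros; rfl

theorem castSource_injective {m m' n : ℕ} (h : m = m') :
    Function.Injective (castSource h : ExtHom r m n → ExtHom r m' n) := by
  subst h
  exact fun _ _ h => h

theorem comp_castSource {m m' n k : ℕ} (h : m = m') (v : ExtHom r n k) (u : ExtHom r m n) :
    comp v (castSource h u) = castSource h (comp v u) := by
  subst h
  rfl

/-- The relation used below transports only the target, while `id_zero_tensor` transports both ends;
this passes between the two. -/
theorem mk_cast_rfl {m n m' n' : ℕ} (hm : m = m') (hn : n = n') (t : ExtTerm r m n) :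
    mk (t.cast rfl hn) = castSource hm.symm (mk (t.cast hm hn)) := by
  subst hm hn
  rfl

theorem mk_id_zero_tensor {m n : ℕ} (u : ExtTerm r m n) :
    mk ((ExtTerm.tensor (.id r 0) u).cast rfl (Nat.zero_add n)) =
      castSource (Nat.zero_add m).symm (mk u) := by
  rw [mk_cast_rfl (Nat.zero_add m) (Nat.zero_add n)]
  exact congrArg _ (Quot.sound (.id_zero_tensor u))

theorem mk_tensor_id_zero {m n : ℕ} (u : ExtTerm r m n) :
    mk (ExtTerm.tensor u (.id r 0)) = mk u :=
  Quot.sound (.tensor_id_zero u)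

/-- The case `m = 0` of `i_p_right`, whose source is literally `0 + (2 * r - 1)`; the transport is
pulled out of the sum and cancelled by injectivity. -/
theorem sum_i_comp_p (r : ℕ) :
    comp (mk (.i true)) (mk (.p true)) + comp (mk (.i false)) (mk (.p false)) =
      comp (mk (.f r (2 * r - 1))) (mk (.f r (2 * r - 1))) := by
  apply castSource_injective (Nat.zero_add (2 * r - 1)).symm
  have h := Quot.sound (ExtTerm.Rel.i_p_right (r := r) 0 (Nat.zero_le _))
  change comp (mk (ExtTerm.tensor (.i true) (.id r 0)))
      (mk ((ExtTerm.tensor (.id r 0) (.p true)).cast rfl (Nat.zero_add (r - 1)))) +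
    comp (mk (ExtTerm.tensor (.i false) (.id r 0)))
      (mk ((ExtTerm.tensor (.id r 0) (.p false)).cast rfl (Nat.zero_add (r - 1)))) =
    comp (mk (ExtTerm.tensor (.f r (2 * r - 1)) (.id r 0)))
      (mk ((ExtTerm.tensor (.id r 0) (.f r (2 * r - 1))).cast rfl (Nat.zero_add (2 * r - 1))))
    at h
  rw [mk_id_zero_tensor, mk_id_zero_tensor, mk_id_zero_tensor] at h
  erw [mk_tensor_id_zero, mk_tensor_id_zero, mk_tensor_id_zero] at h
  rw [comp_castSource, comp_castSource, comp_castSource, ← map_add] at h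
  exact h

end ExtHom

namespace ExtTL

variable {r : ℕ}

/-- The combinations of endomorphisms which factor through one of the `t_n`. -/
def factoring (X : ExtTL r) : Submodule ℂ (X ⟶ X) :=
  Submodule.span ℂ {x | ∃ (n : Fin (2 * r - 1)) (u : X ⟶ ⟨n⟩) (v : ⟨n⟩ ⟶ X),
    x = u ≫ ExtTL.t r n n.isLt ≫ v}

theorem comp_comp_mem_factoring {X Y : ExtTL r} {x : Y ⟶ Y} (hx : x ∈ factoring Y) (u : X ⟶ Y)
    (v : Y ⟶ X) : u ≫ x ≫ v ∈ factoring X := by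
  induction hx using Submodule.span_induction with
  | mem x h =>
    obtain ⟨n, u', v', rfl⟩ := h
    exact Submodule.subset_span ⟨n, u ≫ u', v' ≫ v, by simp only [Category.assoc]⟩
  | zero => simp
  | add x y _ _ hx hy =>
    rw [Preadditive.add_comp, Preadditive.comp_add]
    exact add_mem hx hy
  | smul c x _ hx =>
    rw [Linear.smul_comp, Linear.comp_smul]
    exact Submodule.smul_mem _ _ hx

theorem comp_mem_factoring {X Y : ExtTL r} (h : 𝟙 Y ∈ factoring Y) (u : X ⟶ Y) (v : Y ⟶ X) :
    u ≫ v ∈ factoring X := by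
  simpa using comp_comp_mem_factoring h u v

/-- The coefficient 1 cancels the identity; each remaining diagram factors through `m - 2` points,
where the induction hypothesis applies. -/
theorem ofTL_sub_id_mem_factoring {m : ℕ} (ih : ∀ k < m, 𝟙 (⟨k⟩ : ExtTL r) ∈ factoring ⟨k⟩)
    {x : TLHom ℂ m m} (hx : x (PlanarMatching.nested m) = 1) :
    (show (⟨m⟩ : ExtTL r) ⟶ ⟨m⟩ from ExtHom.ofTL r x) - 𝟙 (⟨m⟩ : ExtTL r) ∈ factoring ⟨m⟩ := by
  have e : (show (⟨m⟩ : ExtTL r) ⟶ ⟨m⟩ from ExtHom.ofTL r x) - 𝟙 (⟨m⟩ : ExtTL r) =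
      ExtHom.ofTLₗ r m m (x - TLHom.id ℂ m) := (map_sub (ExtHom.ofTLₗ r m m) x _).symm
  rw [e, ← Finsupp.sum_single (x - TLHom.id ℂ m), Finsupp.sum, map_sum]
  refine Submodule.sum_mem _ fun d hd => ?_
  have hne : d ≠ PlanarMatching.nested m := by
    rintro rfl
    rw [Finsupp.mem_support_iff, Finsupp.sub_apply, hx, TLHom.id, Finsupp.single_eq_same,
      sub_self] at hd
    exact hd rfl
  generalize (x - TLHom.id ℂ m) d = c
  rw [← mul_one c, ← smul_eq_mul, ← Finsupp.smul_single, map_smul]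
  refine Submodule.smul_mem _ _ ?_
  obtain ⟨i, hi, hdi⟩ := PlanarMatching.exists_arc_of_ne_nested hne
  obtain ⟨k, rfl⟩ : ∃ k, m = k + 2 := ⟨m - 2, by omega⟩
  obtain ⟨v, u, h⟩ :=
    TLHom.exists_comp_eq_single (loopValue (specialA r)) (show i ≤ k by omega) d hdi
  rw [h]
  have e' : ExtHom.ofTLₗ r _ _ (TLHom.comp (loopValue (specialA r)) v u) =
      ExtHom.comp (ExtHom.ofTL r v) (ExtHom.ofTL r u) := Quot.sound (.ofTL_comp v u)
  rw [e']
  exact comp_mem_factoring (Y := ⟨k⟩) (ih k (by omega)) (ExtHom.ofTL r u) (ExtHom.ofTL r v)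

theorem id_mem_factoring (hodd : Odd r) (m : ℕ) : 𝟙 (⟨m⟩ : ExtTL r) ∈ factoring ⟨m⟩ := by
  have hr := hodd.pos
  induction m using Nat.strong_induction_on with
  | _ m ih =>
  obtain hm | rfl | hm := lt_trichotomy m (2 * r - 1)
  · have h := ofTL_sub_id_mem_factoring ih
      (TLHom.specialize_nested (a := specialA r) (tGen_nested hodd m hm))
    have ht : ExtTL.t r m hm ∈ factoring ⟨m⟩ :=
      Submodule.subset_span ⟨⟨m, hm⟩, 𝟙 _, 𝟙 _, by simp⟩
    have := sub_mem ht h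
    change ExtTL.t r m hm - (ExtTL.t r m hm - _) ∈ _ at this
    rwa [sub_sub_cancel] at this
  · set X : ExtTL r := ⟨2 * r - 1⟩
    let f : X ⟶ X := ExtHom.ofTL r (fSpec r (2 * r - 1))
    have h : f - 𝟙 X ∈ factoring X := ofTL_sub_id_mem_factoring ih
      (TLHom.specialize_nested (a := specialA r) (fGen_nested _))
    have hr := ih (r - 1) (by omega)
    let p (ε : Bool) : X ⟶ (⟨r - 1⟩ : ExtTL r) := ExtHom.mk (.p ε)
    let i (ε : Bool) : (⟨r - 1⟩ : ExtTL r) ⟶ X := ExtHom.mk (.i ε)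
    have hf : f ≫ f = p true ≫ i true + p false ≫ i false := (ExtHom.sum_i_comp_p r).symm
    have hff : f ≫ f ∈ factoring X := hf ▸
      add_mem (comp_mem_factoring hr _ _) (comp_mem_factoring hr _ _)
    -- This is `f ≫ f - f`. Together with `hff` and `h` it yields the identity without any appeal to
    -- the idempotence of `f`.
    have h' := comp_comp_mem_factoring h f (𝟙 X)
    rw [Category.comp_id, Preadditive.comp_sub, Category.comp_id] at h'
    have := sub_mem hff (add_mem h' h)
    rwa [show f ≫ f - (f ≫ f - f + (f - 𝟙 X)) = 𝟙 X by abel] at this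
  · obtain ⟨l, rfl⟩ : ∃ l, m = 2 * r - 1 + l := ⟨m - (2 * r - 1), by omega⟩
    -- A generator factors through `n` points with `n ≤ 2r - 2`, so after tensoring it factors
    -- through `n + l < m` points, whose identity is covered by the induction hypothesis.
    have key : ∀ x : (⟨2 * r - 1⟩ : ExtTL r) ⟶ ⟨2 * r - 1⟩, x ∈ factoring _ →
        (ExtHom.tensorId l x : (⟨2 * r - 1 + l⟩ : ExtTL r) ⟶ _) ∈ factoring _ := by
      intro x hx
      induction hx using Submodule.span_induction with
      | mem x h =>
        obtain ⟨n, u, v, rfl⟩ := h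
        have hn := n.isLt
        have e : ExtHom.tensorId l (u ≫ ExtTL.t r n n.isLt ≫ v) =
            ExtHom.comp (ExtHom.tensorId l (ExtTL.t r n n.isLt ≫ v)) (ExtHom.tensorId l u) :=
          ExtHom.tensorId_comp l _ _
        rw [e]
        exact comp_mem_factoring (X := ⟨2 * r - 1 + l⟩) (Y := ⟨n + l⟩) (ih (n + l) (by omega))
          (ExtHom.tensorId l u) (ExtHom.tensorId l (ExtTL.t r n n.isLt ≫ v))
      | zero =>
        rw [map_zero]
        exact zero_mem _
      | add x y _ _ hx hy =>
        rw [map_add]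
        exact add_mem hx hy
      | smul c x _ hx =>
        rw [map_smul]
        exact Submodule.smul_mem _ _ hx
    have h := key _ (ih (2 * r - 1) hm)
    have e : ExtHom.tensorId l (𝟙 (⟨2 * r - 1⟩ : ExtTL r)) = 𝟙 (⟨2 * r - 1 + l⟩ : ExtTL r) :=
      ExtHom.tensorId_id l (2 * r - 1)
    rwa [e] at h

theorem exists_sum_of_mem_factoring {X : ExtTL r} {x : X ⟶ X} (hx : x ∈ factoring X) :
    ∃ (J : Fin (2 * r - 1) → ℕ)
      (u : (n : Fin (2 * r - 1)) → Fin (J n) → (X ⟶ (⟨n⟩ : ExtTL r)))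
      (v : (n : Fin (2 * r - 1)) → Fin (J n) → ((⟨n⟩ : ExtTL r) ⟶ X)),
      x = ∑ n : Fin (2 * r - 1), ∑ j : Fin (J n), u n j ≫ ExtTL.t r n n.isLt ≫ v n j := by
  obtain ⟨N, c, g, rfl⟩ := (Submodule.mem_span_set' (R := ℂ)).1 hx
  choose k u v h using fun j => (g j).2
  -- All `n` share the index set of the spanning combination; the term `j` is put at `n = k j`, with
  -- zero morphisms elsewhere, and its scalar goes into `u`.
  refine ⟨fun _ => N, fun n j => if e : k j = n then c j • (e ▸ u j) else 0,
    fun n j => if e : k j = n then e ▸ v j else 0, ?_⟩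
  rw [Finset.sum_comm]
  refine Finset.sum_congr rfl fun j _ => ?_
  rw [Finset.sum_eq_single (k j)]
  · beta_reduce
    rw [dif_pos rfl, dif_pos rfl, h, Linear.smul_comp]
  · intro n _ hn
    beta_reduce
    rw [dif_neg hn.symm, Limits.zero_comp]
  · simp

end ExtTL

theorem propositionP (r : ℕ) (hodd : Odd r) (hr : 3 ≤ r) :
    (∀ (n : ℕ) (hn : n < 2 * r - 1), (tGen r n hn).RegularAt (specialA r)) ∧
    (fGen (2 * r - 1)).RegularAt (specialA r) ∧
    ∀ m : ExtTL r,
      ∃ (J : Fin (2 * r - 1) → ℕ)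
        (u : (n : Fin (2 * r - 1)) → Fin (J n) → (m ⟶ (⟨n⟩ : ExtTL r)))
        (v : (n : Fin (2 * r - 1)) → Fin (J n) → ((⟨n⟩ : ExtTL r) ⟶ m)),
        𝟙 m = ∑ n : Fin (2 * r - 1), ∑ j : Fin (J n), u n j ≫ ExtTL.t r n n.isLt ≫ v n j := by
  obtain ⟨R, rfl⟩ : ∃ R, r = R + 1 := ⟨r - 1, by omega⟩
  refine ⟨tGen_regularAt (by omega) hodd, ?_, fun m =>
    ExtTL.exists_sum_of_mem_factoring (ExtTL.id_mem_factoring hodd m.pts)⟩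
  rw [show 2 * (R + 1) - 1 = 2 * R + 1 by omega]
  exact fGen_regularAt (by omega) hodd

end
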